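/- Let $\mathrm S$ be an arbitrary dependently typed theory (with the four judgement forms $A\ \mathsf{type}$, $A=B\ \mathsf{type}$, $a:A$, $a=b:A$ in context and the usual structural rules) that admits identity types $\mathsf{Id}_A(a,b)$, with formation, introduction $\mathsf r(a):\mathsf{Id}_A(a,a)$, elimination and computation rules (the last two in the form with an arbitrary postcontext), and whose identity types are discrete: if $p,q:\mathsf{Id}_A(a,b)$ and $\mathsf{Id}_{\mathsf{Id}_A(a,b)}(p,q)$ is inhabited, then $p=q:\mathsf{Id}_A(a,b)$ definitionally. Everything is taken modulo definitional equality. For a context $\Phi$, the identity context $\mathsf{Id}_\Phi(\vec x,\vec y)$, with its reflexivity $\mathsf r(\vec x):\mathsf{Id}_\Phi(\vec x,\vec x)$ and its elimination rule, is defined by induction on the length of $\Phi$: $\mathsf{Id}_{(\,)}=(\,)$ and $$\mathsf{Id}_{(\Lambda,D)}\big((\vec x_1,x_2),(\vec y_1,y_2)\big)=\big(\vec p:\mathsf{Id}_\Lambda(\vec x_1,\vec y_1),\ q:\mathsf{Id}_{D(\vec x_1)}(x_2,\vec p^{\,*}y_2)\big),$$ where $\vec p^{\,*}:D(\vec y_1)\to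 D(\vec x_1)$ is the transport defined by elimination over $\mathsf{Id}_\Lambda$ with $\mathsf r(\vec x)^*z=z$. Let $\mathfrak C_{\mathrm S}$ be the $2$-category whose objects are the contexts of $\mathrm S$, whose $1$-cells $f:\Gamma\to\Delta$ are the judgements $\vec x:\Gamma\vdash \vec f(\vec x):\Delta$, and whose $2$-cells $\alpha:f\Rightarrow g:\Gamma\to\Delta$ are the judgements $\vec x:\Gamma\vdash\vec\alpha(\vec x):\mathsf{Id}_\Delta(\vec f\vec x,\vec g\vec x)$; the whiskering of a $2$-cell $\alpha$ of maps $\Lambda\to\Gamma$ with $f:\Gamma\to\Delta$ is $(f\alpha)(\vec x)=f^\bullet(\vec\alpha(\vec x))$, where $f^\bullet:\mathsf{Id}_\Gamma(\vec x,\vec y)\to\mathsf{Id}_\Delta(\vec f\vec x,\vec f\vec y)$ is defined by elimination with $f^\bullet(\mathsf r(\vec x))=\mathsf r(\vec f\vec x)$. Then for every context $\Delta$, every type $B$ in context $\Delta$ and every $f:\Gamma\to\Delta$, the square $$\begin{array}{ccc}\Gamma.f^*B&\xrightarrow{\;f.\bar f\;}&\Delta.B\\ {\scriptstyle\pi_{f^*B}}\downarrow&&\downarrow{\scriptstyle\pi_B}\\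 \Gamma&\xrightarrow{\;\;f\;\;}&\Delta\end{array}$$ in which $f^*B=B(\vec f(\vec x))$, $(f.\bar f)(\vec x,y)=(\vec f(\vec x),y)$ and the vertical maps are the projections, is a pullback and also a $2$-pullback in $\mathfrak C_{\mathrm S}$: it commutes; for all $h:\Lambda\to\Gamma$ and $k:\Lambda\to\Delta.B$ with $fh=\pi_Bk$ there is a unique $l:\Lambda\to\Gamma.f^*B$ with $\pi_{f^*B}\,l=h$ and $(f.\bar f)\,l=k$; and for all $h,k:\Lambda\to\Gamma.f^*B$ and all $2$-cells $\alpha:\pi_{f^*B}h\Rightarrow\pi_{f^*B}k$ and $\beta:(f.\bar f)h\Rightarrow(f.\bar f)k$ with $f\alpha=\pi_B\beta$ there is a unique $2$-cell $\gamma:h\Rightarrow k$ with $\pi_{f^*B}\gamma=\alpha$ and $(f.\bar f)\gamma=\beta$. -/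

import Mathlib

universe u v

namespace TwoDimTT

/-! ### Raw expressions

Raw type and term expressions up to renaming of bound variables, with de Bruijn indices for the
free variables (`0` is the most recently declared one) and capture-avoiding simultaneous
substitution.  Every system of expressions with variable binding is an instance. -/

/-- The raw expressions of a dependently typed calculus. -/
structure RawExpr where
  Ty : Type u
  Tm : Type v
  var : ℕ → Tm
  /-- `subTy σ A` is `A[σ]`, the variable `i` being replaced by `σ i`. -/
  subTy : (ℕ → Tm) → Ty → Ty
  subTm : (ℕ → Tm) → Tm → Tm
  subTm_var : ∀ σ i, subTm σ (var i) = σ i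
  subTm_id : ∀ t, subTm var t = t
  subTy_id : ∀ A, subTy var A = A
  subTm_comp : ∀ σ τ t, subTm τ (subTm σ t) = subTm (fun i => subTm τ (σ i)) t
  subTy_comp : ∀ σ τ A, subTy τ (subTy σ A) = subTy (fun i => subTm τ (σ i)) A

namespace RawExpr

variable (S : RawExpr.{u, v})

/-- Raw contexts and raw telescopes: lists of types, the most recent one first.  Each entry may
mention the entries that come after it in the list.  The context `Γ` followed by the telescope
`Θ` is the list `Θ ++ Γ`, and `Γ.A` is `A :: Γ`. -/
abbrev Ctx := List S.Ty

/-- Raw vectors of terms (only as many entries matter as the target context has). -/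
abbrev Sub := ℕ → S.Tm

variable {S}

/-- The composite `σ ∘ τ`: substitute `τ` in the entries of `σ`. -/
def comp (σ τ : S.Sub) : S.Sub := fun i => S.subTm τ (σ i)

/-- The vector `(σ, a)`. -/
def snoc (σ : S.Sub) (a : S.Tm) : S.Sub
  | 0 => a
  | i + 1 => σ i

/-- The vector `σ` without its last entry. -/
def init (σ : S.Sub) : S.Sub := fun i => σ (i + 1)

variable (S) in
/-- Weakening by one variable. -/
def wk : S.Sub := fun i => S.var (i + 1)

/-- `σ` carried under a binder: `(x, y) ↦ (σ x, y)`. -/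
def up (σ : S.Sub) : S.Sub := snoc (comp σ S.wk) (S.var 0)

/-- `σ` carried under `n` binders. -/
def upN : ℕ → S.Sub → S.Sub
  | 0, σ => σ
  | n + 1, σ => up (upN n σ)

/-- Substitution in a telescope. -/
def subTele (σ : S.Sub) : List S.Ty → List S.Ty
  | [] => []
  | A :: Θ => S.subTy (upN Θ.length σ) A :: subTele σ Θ

/-- `HasVar Γ i A`: the variable `i` is declared in `Γ` with type `A`. -/
inductive HasVar : S.Ctx → ℕ → S.Ty → Prop
  | zero (Γ : S.Ctx) (A : S.Ty) : HasVar (A :: Γ) 0 (S.subTy S.wk A)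
  | succ {Γ : S.Ctx} {i : ℕ} {A : S.Ty} (B : S.Ty) (h : HasVar Γ i A) :
      HasVar (B :: Γ) (i + 1) (S.subTy S.wk A)

end RawExpr

open RawExpr

/-! ### Calculi with the four judgement forms -/

/-- The derivable judgements of a calculus, for the four basic judgement forms. -/
structure Judgements extends RawExpr.{u, v} where
  /-- `Γ ⊢ A type` -/
  IsTy : List Ty → Ty → Prop
  /-- `Γ ⊢ A = B type` -/
  EqTy : List Ty → Ty → Ty → Prop
  /-- `Γ ⊢ a : A` -/
  IsTm : List Ty → Tm → Ty → Prop
  /-- `Γ ⊢ a = b : A` -/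
  EqTm : List Ty → Tm → Tm → Ty → Prop

namespace Judgements

variable (S : Judgements.{u, v})

/-- `Γ ctxt` -/
def IsCtx : S.Ctx → Prop
  | [] => True
  | A :: Γ => IsCtx Γ ∧ S.IsTy Γ A

/-- `Γ ⊢ Θ = Θ'` for telescopes over the context `Γ`. -/
def EqTele (Γ : S.Ctx) : List S.Ty → List S.Ty → Prop
  | [], [] => S.IsCtx Γ
  | A :: Θ, A' :: Θ' => EqTele Γ Θ Θ' ∧ S.EqTy (Θ ++ Γ) A A'
  | _, _ => False

/-- `IsMor Γ Δ σ`: the judgement `x : Γ ⊢ σ(x) : Δ`, so that `σ` represents a morphism `Γ → Δ`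
of the category of contexts. -/
def IsMor (Γ : S.Ctx) : S.Ctx → S.Sub → Prop
  | [], _ => S.IsCtx Γ
  | A :: Δ, σ => IsMor Γ Δ (init σ) ∧ S.IsTy Δ A ∧ S.IsTm Γ (σ 0) (S.subTy (init σ) A)

/-- `EqMor Γ Δ σ τ`: the judgement `x : Γ ⊢ σ(x) = τ(x) : Δ`, so that `σ` and `τ` represent the
same morphism `Γ → Δ` of the category of contexts. -/
def EqMor (Γ : S.Ctx) : S.Ctx → S.Sub → S.Sub → Prop
  | [], _, _ => S.IsCtx Γ
  | A :: Δ, σ, τ => EqMor Γ Δ (init σ) (init τ) ∧ S.IsTy Δ A ∧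
      S.EqTm Γ (σ 0) (τ 0) (S.subTy (init σ) A)

end Judgements

/-- A dependently typed theory: the four forms of judgement, closed under the structural rules
(presuppositions, equality, conversion, variables, substitution).  Weakening is substitution
along `wk`. -/
structure TypeTheory extends Judgements.{u, v} where
  isCtx_of_isTy : ∀ {Γ A}, IsTy Γ A → toJudgements.IsCtx Γ
  isTy_of_isTm : ∀ {Γ a A}, IsTm Γ a A → IsTy Γ A
  eqTy_left : ∀ {Γ A B}, EqTy Γ A B → IsTy Γ A
  eqTm_left : ∀ {Γ a b A}, EqTm Γ a b A → IsTm Γ a A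
  eqTy_refl : ∀ {Γ A}, IsTy Γ A → EqTy Γ A A
  eqTy_symm : ∀ {Γ A B}, EqTy Γ A B → EqTy Γ B A
  eqTy_trans : ∀ {Γ A B C}, EqTy Γ A B → EqTy Γ B C → EqTy Γ A C
  eqTm_refl : ∀ {Γ a A}, IsTm Γ a A → EqTm Γ a a A
  eqTm_symm : ∀ {Γ a b A}, EqTm Γ a b A → EqTm Γ b a A
  eqTm_trans : ∀ {Γ a b c A}, EqTm Γ a b A → EqTm Γ b c A → EqTm Γ a c A
  isTm_conv : ∀ {Γ a A B}, IsTm Γ a A → EqTy Γ A B → IsTm Γ a B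
  eqTm_conv : ∀ {Γ a b A B}, EqTm Γ a b A → EqTy Γ A B → EqTm Γ a b B
  isTm_var : ∀ {Γ i A}, toJudgements.IsCtx Γ → HasVar (S := toRawExpr) Γ i A → IsTm Γ (var i) A
  isTy_sub : ∀ {Γ Δ σ A}, toJudgements.IsMor Γ Δ σ → IsTy Δ A → IsTy Γ (subTy σ A)
  eqTy_sub : ∀ {Γ Δ σ A B}, toJudgements.IsMor Γ Δ σ → EqTy Δ A B →
    EqTy Γ (subTy σ A) (subTy σ B)
  isTm_sub : ∀ {Γ Δ σ a A}, toJudgements.IsMor Γ Δ σ → IsTm Δ a A →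
    IsTm Γ (subTm σ a) (subTy σ A)
  eqTm_sub : ∀ {Γ Δ σ a b A}, toJudgements.IsMor Γ Δ σ → EqTm Δ a b A →
    EqTm Γ (subTm σ a) (subTm σ b) (subTy σ A)
  eqTy_sub_congr : ∀ {Γ Δ σ τ A}, toJudgements.EqMor Γ Δ σ τ → IsTy Δ A →
    EqTy Γ (subTy σ A) (subTy τ A)
  eqTm_sub_congr : ∀ {Γ Δ σ τ a A}, toJudgements.EqMor Γ Δ σ τ → IsTm Δ a A →
    EqTm Γ (subTm σ a) (subTm τ a) (subTy σ A)

/-! ### Identity types -/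

/-- The type formers, term formers and eliminators of identity types on raw expressions; they
commute with substitution. -/
structure IdOps (S : RawExpr.{u, v}) where
  /-- `Id_A(a, b)` -/
  Id : S.Ty → S.Tm → S.Tm → S.Ty
  /-- `r(a) : Id_A(a, a)` -/
  r : S.Ty → S.Tm → S.Tm
  /-- `J A Θ C d` is the term `J_d(x, y, p)` in the context `x, y : A, p : Id_A(x, y), Θ`; the
  type `C` lives in this context and the term `d` in `x : A, Θ[x, x, r(x) / x, y, p]`. -/
  J : S.Ty → List S.Ty → S.Ty → S.Tm → S.Tm
  Id_sub : ∀ σ A a b, S.subTy σ (Id A a b) = Id (S.subTy σ A) (S.subTm σ a) (S.subTm σ b)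
  r_sub : ∀ σ A a, S.subTm σ (r A a) = r (S.subTy σ A) (S.subTm σ a)
  J_sub : ∀ σ A Θ C d,
    S.subTm (upN Θ.length (upN 3 σ)) (J A Θ C d) =
      J (S.subTy σ A) (subTele (upN 3 σ) Θ) (S.subTy (upN Θ.length (upN 3 σ)) C)
        (S.subTm (upN Θ.length (up σ)) d)

namespace IdOps

variable {S : RawExpr.{u, v}} (I : IdOps S)

/-- The telescope `x : A, y : A, p : Id_A(x, y)`. -/
def path (A : S.Ty) : List S.Ty :=
  [I.Id (S.subTy S.wk (S.subTy S.wk A)) (S.var 1) (S.var 0), S.subTy S.wk A, A]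

/-- The vector `x : A ⊢ (x, x, r(x))`, over the identity of the ambient context. -/
def diag (A : S.Ty) : S.Sub :=
  snoc (snoc (snoc S.wk (S.var 0)) (S.var 0)) (I.r (S.subTy S.wk A) (S.var 0))

end IdOps

/-- The rules for identity types in the theory `S`: formation, introduction, elimination and
computation (both with a postcontext `Θ`), compatibility of the operations with definitional
equality, and discreteness of identity types.  The ambient context `Γ` is arbitrary. -/
structure DiscreteIdTypes (S : TypeTheory.{u, v}) extends IdOps S.toRawExpr where
  isTy_Id : ∀ {Γ A a b}, S.IsTm Γ a A → S.IsTm Γ b A → S.IsTy Γ (Id A a b)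
  eqTy_Id : ∀ {Γ A A' a a' b b'}, S.EqTy Γ A A' → S.EqTm Γ a a' A → S.EqTm Γ b b' A →
    S.EqTy Γ (Id A a b) (Id A' a' b')
  isTm_r : ∀ {Γ A a}, S.IsTm Γ a A → S.IsTm Γ (r A a) (Id A a a)
  eqTm_r : ∀ {Γ A A' a a'}, S.EqTy Γ A A' → S.EqTm Γ a a' A →
    S.EqTm Γ (r A a) (r A' a') (Id A a a)
  isTm_J : ∀ {Γ A Θ C d}, S.IsTy Γ A → S.IsTy (Θ ++ (toIdOps.path A ++ Γ)) C →
    S.IsTm (subTele (toIdOps.diag A) Θ ++ (A :: Γ)) d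
      (S.subTy (upN Θ.length (toIdOps.diag A)) C) →
    S.IsTm (Θ ++ (toIdOps.path A ++ Γ)) (J A Θ C d) C
  eqTm_J : ∀ {Γ A A' Θ Θ' C C' d d'}, S.EqTy Γ A A' →
    S.EqTele (toIdOps.path A ++ Γ) Θ Θ' → S.EqTy (Θ ++ (toIdOps.path A ++ Γ)) C C' →
    S.EqTm (subTele (toIdOps.diag A) Θ ++ (A :: Γ)) d d'
      (S.subTy (upN Θ.length (toIdOps.diag A)) C) →
    S.EqTm (Θ ++ (toIdOps.path A ++ Γ)) (J A Θ C d) (J A' Θ' C' d') C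
  J_comp : ∀ {Γ A Θ C d}, S.IsTy Γ A → S.IsTy (Θ ++ (toIdOps.path A ++ Γ)) C →
    S.IsTm (subTele (toIdOps.diag A) Θ ++ (A :: Γ)) d
      (S.subTy (upN Θ.length (toIdOps.diag A)) C) →
    S.EqTm (subTele (toIdOps.diag A) Θ ++ (A :: Γ))
      (S.subTm (upN Θ.length (toIdOps.diag A)) (J A Θ C d)) d
      (S.subTy (upN Θ.length (toIdOps.diag A)) C)
  /-- Discreteness: propositionally equal identity proofs are definitionally equal. -/
  disc : ∀ {Γ A a b p q e}, S.IsTm Γ p (Id A a b) → S.IsTm Γ q (Id A a b) →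
    S.IsTm Γ e (Id (Id A a b) p q) → S.EqTm Γ p q (Id A a b)

/-! ### Identity contexts

For a context `Φ`, `idCtx Φ` is the context `x, y : Φ, p : Id_Φ(x, y)` with its variables listed
in the order in which the induction on `Φ` produces them: for `Φ = (Λ, D)` it is

  `x₁, y₁ : Λ, p : Id_Λ(x₁, y₁), x₂ : D(x₁), y₂ : D(y₁), q : Id_{D(x₁)}(x₂, p^* y₂)`.

Thus a vector `Γ → idCtx Φ` consists of vectors `f, g : Γ → Φ` together with a vector
`x : Γ ⊢ α(x) : Id_Φ(f x, g x)`. -/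

namespace IdOps

variable {S : RawExpr.{u, v}} (I : IdOps S)

/-- The vector `x, y : Φ, p : Id_Φ(x, y) ⊢ x : Φ`. -/
def src : S.Ctx → S.Sub
  | [] => S.var
  | _ :: Λ => snoc (comp (comp (comp (src Λ) S.wk) S.wk) S.wk) (S.var 2)

/-- The vector `x, y : Φ, p : Id_Φ(x, y) ⊢ y : Φ`. -/
def tgt : S.Ctx → S.Sub
  | [] => S.var
  | _ :: Λ => snoc (comp (comp (comp (tgt Λ) S.wk) S.wk) S.wk) (S.var 1)

/-- The vector `x : Φ ⊢ (x, x, r(x))` into `idCtx Φ`. -/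
def reflCtx : S.Ctx → S.Sub
  | [] => S.var
  | D :: Λ => snoc (snoc (snoc (comp (reflCtx Λ) S.wk) (S.var 0)) (S.var 0))
      (I.r (S.subTy S.wk D) (S.var 0))

/-- The identity context of `D :: Λ` from that of `Λ`, where `t` is the term `p^* z` in the
context `x₁, y₁ : Λ, p : Id_Λ(x₁, y₁), z : D(y₁)`. -/
def idStep (D : S.Ty) (Λ : S.Ctx) (t : S.Tm) : List S.Ty :=
  [I.Id (S.subTy S.wk (S.subTy S.wk (S.subTy (src Λ) D))) (S.var 1)
      (S.subTm (up S.wk) t),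
    S.subTy S.wk (S.subTy (tgt Λ) D),
    S.subTy (src Λ) D]

/-- Elimination over identity contexts with a postcontext `Θ`: `JCtx Φ Θ C d` is a term of type
`C` in the context `x, y : Φ, p : Id_Φ(x, y), Θ`, if `d` has type `C[x, x, r(x)]` in the context
`x : Φ, Θ[x, x, r(x)]`.  For `Φ = (Λ, D)`, one eliminates over the identity context of `Λ`, and
then, in the case of reflexivity, over the identity type of `D`. -/
def JCtx : S.Ctx → List S.Ty → S.Ty → S.Tm → S.Tm
  | [], _, _, d => d
  | D :: Λ, Θ, C, d =>
      JCtx Λ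
        (Θ ++ I.idStep D Λ (JCtx Λ [S.subTy (tgt Λ) D]
          (S.subTy S.wk (S.subTy (src Λ) D)) (S.var 0)))
        C
        (I.J D (subTele (upN 3 (I.reflCtx Λ)) Θ)
          (S.subTy (upN Θ.length (upN 3 (I.reflCtx Λ))) C) d)

/-- The Leibniz rule: the term `p^* z : D(x)` in the context
`x, y : Λ, p : Id_Λ(x, y), z : D(y)`, with `r(x)^* z = z`. -/
def transport (Λ : S.Ctx) (D : S.Ty) : S.Tm :=
  I.JCtx Λ [S.subTy (tgt Λ) D] (S.subTy S.wk (S.subTy (src Λ) D)) (S.var 0)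

/-- The context `x, y : Φ, p : Id_Φ(x, y)`. -/
def idCtx : S.Ctx → S.Ctx
  | [] => []
  | D :: Λ => I.idStep D Λ (I.transport Λ D) ++ idCtx Λ

/-- The lifting of `f : Γ → Δ` to identity contexts, `(x, y, p) ↦ (f x, f y, f^•(p))`; the
components of `f^•` are defined one after the other by elimination over the identity context of
`Γ`, with `f^•(r(x)) = r(f x)`. -/
def lift (Γ : S.Ctx) : S.Ctx → S.Sub → S.Sub
  | [], _ => S.var
  | D :: Λ, f =>
      snoc
        (snoc (snoc (lift Γ Λ (init f)) (S.subTm (src Γ) (f 0))) (S.subTm (tgt Γ) (f 0)))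
        (I.JCtx Γ []
          (I.Id (S.subTy (comp (init f) (src Γ)) D) (S.subTm (src Γ) (f 0))
            (S.subTm (snoc (lift Γ Λ (init f)) (S.subTm (tgt Γ) (f 0))) (I.transport Λ D)))
          (I.r (S.subTy (init f) D) (f 0)))

end IdOps

/-! ### The 2-category of contexts

Objects are contexts, 1-cells are vectors of terms, and 2-cells are vectors of identity proofs, all
taken modulo definitional equality: `EqMor` and `EqCell` are the equalities of 1-cells and of
2-cells. -/

namespace Judgements

/-- The square of contexts and morphisms

```
  P --snd--> Y
  |          |
 fst         g
  v          v
  X --f----> Z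
```

commutes and is a pullback in the category of contexts (modulo definitional equality). -/
structure IsPullback (S : Judgements.{u, v}) (P X Y Z : S.Ctx) (fst snd f g : S.Sub) : Prop where
  isMor_fst : S.IsMor P X fst
  isMor_snd : S.IsMor P Y snd
  isMor_left : S.IsMor X Z f
  isMor_right : S.IsMor Y Z g
  comm : S.EqMor P Z (comp f fst) (comp g snd)
  exists_lift : ∀ (Λ : S.Ctx) (h k : S.Sub), S.IsMor Λ X h → S.IsMor Λ Y k →
    S.EqMor Λ Z (comp f h) (comp g k) →
    ∃ l : S.Sub, S.IsMor Λ P l ∧ S.EqMor Λ X (comp fst l) h ∧ S.EqMor Λ Y (comp snd l) k ∧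
      ∀ l' : S.Sub, S.IsMor Λ P l' → S.EqMor Λ X (comp fst l') h →
        S.EqMor Λ Y (comp snd l') k → S.EqMor Λ P l' l

end Judgements

namespace DiscreteIdTypes

variable {S : TypeTheory.{u, v}} (I : DiscreteIdTypes S)

/-- `α` represents a 2-cell `f ⇒ g : Γ → Δ`, that is, a judgement
`x : Γ ⊢ α(x) : Id_Δ(f x, g x)` (recorded together with `f x` and `g x`). -/
def IsCell (Γ Δ : S.Ctx) (f g α : S.Sub) : Prop :=
  S.IsMor Γ (I.idCtx Δ) α ∧ S.EqMor Γ Δ (comp (IdOps.src Δ) α) f ∧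
    S.EqMor Γ Δ (comp (IdOps.tgt Δ) α) g

/-- `α` and `β` represent the same 2-cell between morphisms `Γ → Δ`. -/
def EqCell (Γ Δ : S.Ctx) (α β : S.Sub) : Prop :=
  S.EqMor Γ (I.idCtx Δ) α β

/-- The whiskering `f ∘ α` of a 2-cell `α` between morphisms `Λ → Γ` with `f : Γ → Δ`, that is,
`x : Λ ⊢ f^•(α(x))`. -/
def whisker (Γ Δ : S.Ctx) (f α : S.Sub) : S.Sub :=
  comp (I.lift Γ Δ f) α

/-- The square (as in `IsPullback`) is a 2-pullback in the 2-category of contexts: it is a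
pullback, and for all `h, k : Λ → P` and 2-cells `α : fst h ⇒ fst k`, `β : snd h ⇒ snd k` with
`f α = g β` there is a unique 2-cell `γ : h ⇒ k` with `fst γ = α` and `snd γ = β`. -/
structure IsTwoPullback (P X Y Z : S.Ctx) (fst snd f g : S.Sub) : Prop
    extends S.IsPullback P X Y Z fst snd f g where
  exists_cell : ∀ (Λ : S.Ctx) (h k α β : S.Sub), S.IsMor Λ P h → S.IsMor Λ P k →
    I.IsCell Λ X (comp fst h) (comp fst k) α → I.IsCell Λ Y (comp snd h) (comp snd k) β →
    I.EqCell Λ Z (I.whisker X Z f α) (I.whisker Y Z g β) →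
    ∃ γ : S.Sub, I.IsCell Λ P h k γ ∧ I.EqCell Λ X (I.whisker P X fst γ) α ∧
      I.EqCell Λ Y (I.whisker P Y snd γ) β ∧
      ∀ γ' : S.Sub, I.IsCell Λ P h k γ' → I.EqCell Λ X (I.whisker P X fst γ') α →
        I.EqCell Λ Y (I.whisker P Y snd γ') β → I.EqCell Λ P γ' γ

end DiscreteIdTypes

end TwoDimTT

namespace TwoDimTT

open RawExpr

/-! ### The substitution calculus -/

namespace RawExpr

variable {S : RawExpr.{u, v}}

/-! A 2-cell into `Δ` is a morphism into the identity context of `Δ`, and whiskering with `f` is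
composition with its lift. The two-dimensional universal property therefore follows once the square
and its image under `idCtx` and `lift` are both pullbacks (`isTwoPullback_of_isPullback_idCtx`). The
square itself is an instance of `isPullback_subTele`: base change of any telescope is a pullback.

For the image, base change of the identity telescope of `B` along the lift of `f` gives a pullback
`Q`, whose last entry is a proof `q : Id(x, (f^• p)^* y)`. The identity context of `Γ.f^*B` asks
instead for a proof of `Id(x, p^* y)`. The two transports need not agree definitionally, but both
are the identity at reflexivity, so elimination gives a map `V` from `Q` to the identity context.
The universal property of `Q` gives a map `W` back.

Discreteness makes this comparison strict. Two terms of an identity type that agree at reflexivities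
are propositionally equal by elimination, hence definitionally equal (`eqTm_of_elimAlong`). So maps
into identity contexts are determined by source, target and values at reflexivities
(`eqMor_of_elimAlong`). This yields functoriality of lifting, compatibility of `V` with the
projections, and `V ∘ W = 1`; a retract of a pullback cone is a pullback cone. -/

@[simp] theorem snoc_zero (σ : S.Sub) (a : S.Tm) : snoc σ a 0 = a := rfl
@[simp] theorem snoc_one (σ : S.Sub) (a : S.Tm) : snoc σ a 1 = σ 0 := rfl
@[simp] theorem snoc_two (σ : S.Sub) (a : S.Tm) : snoc σ a 2 = σ 1 := rfl
@[simp] theorem init_apply (σ : S.Sub) (i : ℕ) : init σ i = σ (i + 1) := rfl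
@[simp] theorem init_snoc (σ : S.Sub) (a : S.Tm) : init (snoc σ a) = σ := rfl
@[simp] theorem wk_eq : S.wk = init S.var := rfl
@[simp] theorem comp_init (σ τ : S.Sub) : comp (init σ) τ = init (comp σ τ) := rfl
@[simp] theorem comp_apply (σ τ : S.Sub) (i : ℕ) : comp σ τ i = S.subTm τ (σ i) := rfl
@[simp] theorem subTm_var' (σ : S.Sub) (i : ℕ) : S.subTm σ (S.var i) = σ i := S.subTm_var σ i
@[simp] theorem subTm_id' (t : S.Tm) : S.subTm S.var t = t := S.subTm_id t
@[simp] theorem subTy_id' (A : S.Ty) : S.subTy S.var A = A := S.subTy_id A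
@[simp] theorem subTm_subTm (σ τ : S.Sub) (t : S.Tm) :
    S.subTm τ (S.subTm σ t) = S.subTm (comp σ τ) t := S.subTm_comp σ τ t
@[simp] theorem subTy_subTy (σ τ : S.Sub) (A : S.Ty) :
    S.subTy τ (S.subTy σ A) = S.subTy (comp σ τ) A := S.subTy_comp σ τ A
@[simp] theorem comp_var (σ : S.Sub) : comp σ S.var = σ := funext fun _ => S.subTm_id _
@[simp] theorem var_comp (σ : S.Sub) : comp S.var σ = σ := funext fun _ => S.subTm_var _ _
@[simp] theorem comp_assoc (σ τ ρ : S.Sub) : comp (comp σ τ) ρ = comp σ (comp τ ρ) :=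
  funext fun _ => S.subTm_comp _ _ _
@[simp] theorem comp_snoc (σ τ : S.Sub) (a : S.Tm) :
    comp (snoc σ a) τ = snoc (comp σ τ) (S.subTm τ a) := by
  funext i; cases i <;> rfl
@[simp] theorem snoc_eta (σ : S.Sub) : snoc (init σ) (σ 0) = σ := by
  funext i; cases i <;> rfl
@[simp] theorem snoc_eta_one (σ : S.Sub) : snoc (init (init σ)) (σ 1) = init σ := by
  funext i; cases i <;> rfl
@[simp] theorem snoc_eta_two (σ : S.Sub) : snoc (init (init (init σ))) (σ 2) = init (init σ) := by
  funext i; cases i <;> rfl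
theorem up_eq (σ : S.Sub) : up σ = snoc (comp σ (init S.var)) (S.var 0) := rfl

@[simp] theorem up_var : up S.var = S.var := by simp [up_eq]

theorem up_comp (σ τ : S.Sub) : comp (up σ) (up τ) = up (comp σ τ) := by simp [up_eq]

@[simp] theorem upN_zero (σ : S.Sub) : upN 0 σ = σ := rfl
theorem upN_succ (n : ℕ) (σ : S.Sub) : upN (n + 1) σ = up (upN n σ) := rfl
theorem upN_one (σ : S.Sub) : upN 1 σ = up σ := rfl
theorem upN_two (σ : S.Sub) : upN 2 σ = up (up σ) := rfl
theorem upN_three (σ : S.Sub) : upN 3 σ = up (up (up σ)) := rfl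

@[simp] theorem upN_var (n : ℕ) : upN n S.var = S.var := by
  induction n with
  | zero => rfl
  | succ n ih => rw [upN_succ, ih, up_var]

theorem upN_comp (n : ℕ) (σ τ : S.Sub) : comp (upN n σ) (upN n τ) = upN n (comp σ τ) := by
  induction n with
  | zero => rfl
  | succ n ih => rw [upN_succ, upN_succ, up_comp, ih, upN_succ]

theorem upN_add (m n : ℕ) (σ : S.Sub) : upN (m + n) σ = upN m (upN n σ) := by
  induction m with
  | zero => simp
  | succ m ih => rw [Nat.succ_add, upN_succ, ih, upN_succ]

@[simp] theorem length_subTele (σ : S.Sub) (Θ : List S.Ty) :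
    (subTele σ Θ).length = Θ.length := by
  induction Θ with
  | nil => rfl
  | cons A Θ ih => simp [subTele, ih]

@[simp] theorem subTele_nil (σ : S.Sub) : subTele σ [] = [] := rfl

@[simp] theorem subTele_var (Θ : List S.Ty) : subTele S.var Θ = Θ := by
  induction Θ with
  | nil => rfl
  | cons A Θ ih => simp [subTele, ih]

theorem subTele_subTele (σ τ : S.Sub) (Θ : List S.Ty) :
    subTele τ (subTele σ Θ) = subTele (comp σ τ) Θ := by
  induction Θ with
  | nil => rfl
  | cons A Θ ih => simp [subTele, ih, upN_comp]

theorem subTele_append (σ : S.Sub) (Θ Ξ : List S.Ty) :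
    subTele σ (Θ ++ Ξ) = subTele (upN Ξ.length σ) Θ ++ subTele σ Ξ := by
  induction Θ with
  | nil => rfl
  | cons A Θ ih => simp [subTele, ih, upN_add]

/-- The vector `σ` without its last `n` entries. -/
def drop (n : ℕ) (σ : S.Sub) : S.Sub := fun i => σ (i + n)

theorem drop_succ (n : ℕ) (σ : S.Sub) : drop (n + 1) σ = drop n (init σ) := rfl

theorem drop_three (σ : S.Sub) : drop 3 σ = init (init (init σ)) := rfl

theorem drop_comp (n : ℕ) (σ τ : S.Sub) : drop n (comp σ τ) = comp (drop n σ) τ := rfl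

theorem drop_var_comp (n : ℕ) (σ : S.Sub) : comp (drop n S.var) σ = drop n σ := by
  rw [← drop_comp, var_comp]

theorem drop_upN (n : ℕ) (σ : S.Sub) : drop n (upN n σ) = comp σ (drop n S.var) := by
  induction n with
  | zero => exact (comp_var σ).symm
  | succ n ih =>
    rw [drop_succ, upN_succ, up_eq, init_snoc, drop_comp, ih, comp_assoc, ← drop_comp, var_comp,
      ← drop_succ]

end RawExpr

/-! ### Structural rules for morphisms of contexts -/

namespace TypeTheory

variable {S : TypeTheory.{u, v}} {Γ Γ' Δ Ξ : S.Ctx} {A A' : S.Ty} {a b : S.Tm}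
  {σ σ' τ τ' ρ : S.Sub}

theorem eqTy_right (h : S.EqTy Γ A A') : S.IsTy Γ A' := S.eqTy_left (S.eqTy_symm h)

theorem isMor_dom (h : S.IsMor Γ Δ σ) : S.IsCtx Γ := by
  induction Δ generalizing σ with
  | nil => exact h
  | cons A Δ ih => exact ih h.1

theorem isMor_cod (h : S.IsMor Γ Δ σ) : S.IsCtx Δ := by
  induction Δ generalizing σ with
  | nil => trivial
  | cons A Δ ih => exact ⟨ih h.1, h.2.1⟩

/-- The initial part of an identity vector is a weakening, not an identity, so the induction has to
run over arbitrary vectors checked one variable at a time. -/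
theorem isMor_of_hasVar (hΓ : S.IsCtx Γ) (hΔ : S.IsCtx Δ)
    (h : ∀ i A, HasVar (S := S.toRawExpr) Δ i A → S.IsTm Γ (σ i) (S.subTy σ A)) :
    S.IsMor Γ Δ σ := by
  induction Δ generalizing σ with
  | nil => exact hΓ
  | cons A Δ ih =>
    refine ⟨ih hΔ.1 fun i B hB => ?_, hΔ.2, ?_⟩
    · simpa using h _ _ (HasVar.succ A hB)
    · simpa using h _ _ (HasVar.zero Δ A)

theorem isMor_var (hΓ : S.IsCtx Γ) : S.IsMor Γ Γ S.var :=
  isMor_of_hasVar hΓ hΓ fun i A h => by simpa using S.isTm_var hΓ h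

theorem isMor_wk (hA : S.IsTy Γ A) : S.IsMor (A :: Γ) Γ S.wk :=
  have hΓ : S.IsCtx Γ := S.isCtx_of_isTy hA
  isMor_of_hasVar ⟨hΓ, hA⟩ hΓ fun _ _ h => S.isTm_var (Γ := A :: Γ) ⟨hΓ, hA⟩ (HasVar.succ A h)

theorem isTm_var_zero (hA : S.IsTy Γ A) : S.IsTm (A :: Γ) (S.var 0) (S.subTy S.wk A) :=
  S.isTm_var (Γ := A :: Γ) ⟨S.isCtx_of_isTy hA, hA⟩ (HasVar.zero Γ A)

theorem isMor_comp (h : S.IsMor Γ Δ σ) (hτ : S.IsMor Ξ Γ τ) : S.IsMor Ξ Δ (comp σ τ) := by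
  induction Δ generalizing σ with
  | nil => exact isMor_dom hτ
  | cons A Δ ih =>
    exact ⟨ih h.1, h.2.1, by simpa using S.isTm_sub hτ h.2.2⟩

theorem isMor_snoc (h : S.IsMor Γ Δ σ) (hA : S.IsTy Δ A) (ha : S.IsTm Γ a (S.subTy σ A)) :
    S.IsMor Γ (A :: Δ) (snoc σ a) := ⟨h, hA, ha⟩

theorem isMor_up (h : S.IsMor Γ Δ σ) (hA : S.IsTy Δ A) :
    S.IsMor (S.subTy σ A :: Γ) (A :: Δ) (up σ) :=
  have hA' := S.isTy_sub h hA
  isMor_snoc (isMor_comp h (isMor_wk hA')) hA (by simpa using isTm_var_zero hA')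

theorem isMor_upN (h : S.IsMor Γ Δ σ) {Θ : List S.Ty} (hΘ : S.IsCtx (Θ ++ Δ)) :
    S.IsMor (subTele σ Θ ++ Γ) (Θ ++ Δ) (upN Θ.length σ) := by
  induction Θ with
  | nil => exact h
  | cons A Θ ih => exact isMor_up (ih hΘ.1) hΘ.2

theorem eqMor_left (h : S.EqMor Γ Δ σ τ) : S.IsMor Γ Δ σ := by
  induction Δ generalizing σ τ with
  | nil => exact h
  | cons A Δ ih => exact ⟨ih h.1, h.2.1, S.eqTm_left h.2.2⟩

theorem eqMor_refl (h : S.IsMor Γ Δ σ) : S.EqMor Γ Δ σ σ := by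
  induction Δ generalizing σ with
  | nil => exact h
  | cons A Δ ih => exact ⟨ih h.1, h.2.1, S.eqTm_refl h.2.2⟩

theorem eqMor_symm (h : S.EqMor Γ Δ σ τ) : S.EqMor Γ Δ τ σ := by
  induction Δ generalizing σ τ with
  | nil => exact h
  | cons A Δ ih =>
    exact ⟨ih h.1, h.2.1, S.eqTm_conv (S.eqTm_symm h.2.2) (S.eqTy_sub_congr h.1 h.2.1)⟩

theorem eqMor_right (h : S.EqMor Γ Δ σ τ) : S.IsMor Γ Δ τ := eqMor_left (eqMor_symm h)

theorem eqMor_trans (h : S.EqMor Γ Δ σ τ) (h' : S.EqMor Γ Δ τ ρ) : S.EqMor Γ Δ σ ρ := by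
  induction Δ generalizing σ τ ρ with
  | nil => exact h
  | cons A Δ ih =>
    exact ⟨ih h.1 h'.1, h.2.1, S.eqTm_trans h.2.2
      (S.eqTm_conv h'.2.2 (S.eqTy_symm (S.eqTy_sub_congr h.1 h.2.1)))⟩

theorem eqMor_comp_right (h : S.EqMor Γ Δ σ σ') (hτ : S.IsMor Ξ Γ τ) :
    S.EqMor Ξ Δ (comp σ τ) (comp σ' τ) := by
  induction Δ generalizing σ σ' with
  | nil => exact isMor_dom hτ
  | cons A Δ ih => exact ⟨ih h.1, h.2.1, by simpa using S.eqTm_sub hτ h.2.2⟩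

theorem eqMor_comp_left (h : S.IsMor Γ Δ σ) (hτ : S.EqMor Ξ Γ τ τ') :
    S.EqMor Ξ Δ (comp σ τ) (comp σ τ') := by
  induction Δ generalizing σ with
  | nil => exact isMor_dom (eqMor_left hτ)
  | cons A Δ ih => exact ⟨ih h.1, h.2.1, by simpa using S.eqTm_sub_congr hτ h.2.2⟩

theorem eqMor_comp (h : S.EqMor Γ Δ σ σ') (hτ : S.EqMor Ξ Γ τ τ') :
    S.EqMor Ξ Δ (comp σ τ) (comp σ' τ') :=
  eqMor_trans (eqMor_comp_right h (eqMor_left hτ)) (eqMor_comp_left (eqMor_right h) hτ)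

theorem eqMor_snoc (h : S.EqMor Γ Δ σ τ) (hA : S.IsTy Δ A)
    (ha : S.EqTm Γ a b (S.subTy σ A)) : S.EqMor Γ (A :: Δ) (snoc σ a) (snoc τ b) := ⟨h, hA, ha⟩

theorem isMor_drop {Θ : List S.Ty} (hΘ : S.IsCtx (Θ ++ Γ)) :
    S.IsMor (Θ ++ Γ) Γ (drop Θ.length S.var) := by
  induction Θ with
  | nil => exact isMor_var hΘ
  | cons A Θ ih =>
    have h := isMor_comp (ih hΘ.1) (isMor_wk hΘ.2)
    rwa [drop_var_comp] at h

/-! ### Pullbacks of contexts -/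

/-- The mediating vector is `α` followed by the telescope entries of `β`, each converted along the
equality of types obtained so far. Its projection to `Γ` is therefore `α` on the nose. -/
theorem exists_isMor_subTele {M α β : S.Sub} {Θ : List S.Ty} (hM : S.IsMor Γ Δ M)
    (hα : S.IsMor Ξ Γ α) (hβ : S.IsMor Ξ (Θ ++ Δ) β)
    (e : S.EqMor Ξ Δ (comp M α) (drop Θ.length β)) :
    ∃ l, S.IsMor Ξ (subTele M Θ ++ Γ) l ∧ drop Θ.length l = α ∧
      S.EqMor Ξ (Θ ++ Δ) (comp (upN Θ.length M) l) β := by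
  induction Θ generalizing β with
  | nil => exact ⟨α, hα, rfl, e⟩
  | cons A Θ ih =>
    obtain ⟨l, hl, hlα, hlβ⟩ := ih hβ.1 e
    have hA := S.eqTy_sub_congr hlβ hβ.2.1
    have hb := S.isTm_conv hβ.2.2 (S.eqTy_symm hA)
    have hup := isMor_upN hM (isMor_cod hβ.1)
    refine ⟨snoc l (β 0), ⟨hl, S.isTy_sub hup hβ.2.1, ?_⟩, hlα, ?_⟩
    · simpa using hb
    · have : comp (upN (A :: Θ).length M) (snoc l (β 0)) =
        snoc (comp (upN Θ.length M) l) (β 0) := by simp [upN_succ, up_eq]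
      rw [this]
      exact ⟨hlβ, hβ.2.1, S.eqTm_refl hb⟩

/-- Carrying `M` under binders leaves the telescope entries of `l` untouched, so uniqueness can be
read off entry by entry. -/
theorem eqMor_subTele {M l l' : S.Sub} {Θ : List S.Ty} (hM : S.IsMor Γ Δ M)
    (hΘ : S.IsCtx (Θ ++ Δ)) (e : S.EqMor Ξ Γ (drop Θ.length l) (drop Θ.length l'))
    (e' : S.EqMor Ξ (Θ ++ Δ) (comp (upN Θ.length M) l) (comp (upN Θ.length M) l')) :
    S.EqMor Ξ (subTele M Θ ++ Γ) l l' := by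
  induction Θ generalizing l l' with
  | nil => exact e
  | cons A Θ ih =>
    have h1 : ∀ l : S.Sub, comp (upN (A :: Θ).length M) l =
        snoc (comp (upN Θ.length M) (init l)) (l 0) := fun l => by
      conv_lhs => rw [← snoc_eta l]
      simp [upN_succ, up_eq]
    rw [h1, h1] at e'
    refine ⟨ih hΘ.1 e e'.1, S.isTy_sub (isMor_upN hM hΘ.1) hΘ.2, ?_⟩
    simpa using e'.2.2

theorem isPullback_subTele {M : S.Sub} {Θ : List S.Ty} (hM : S.IsMor Γ Δ M)
    (hΘ : S.IsCtx (Θ ++ Δ)) :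
    S.IsPullback (subTele M Θ ++ Γ) Γ (Θ ++ Δ) Δ (drop Θ.length S.var) (upN Θ.length M) M
      (drop Θ.length S.var) := by
  have hu := isMor_upN hM hΘ
  have hd := isMor_drop (isMor_dom hu)
  rw [length_subTele] at hd
  refine ⟨hd, hu, hM, isMor_drop hΘ, ?_, fun Λ h k hh hk e => ?_⟩
  · rw [drop_var_comp, drop_upN]
    exact eqMor_refl (isMor_comp hM hd)
  · simp only [drop_var_comp] at e ⊢
    obtain ⟨l, hl, rfl, hlk⟩ := exists_isMor_subTele hM hh hk e
    exact ⟨l, hl, eqMor_refl hh, hlk, fun l' _ e1 e2 =>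
      eqMor_subTele hM hΘ e1 (eqMor_trans e2 (eqMor_symm hlk))⟩

section IsPullback

variable {P P' X Y Z Λ : S.Ctx} {fst snd fst' snd' f g g' V W l l' : S.Sub}

theorem _root_.TwoDimTT.Judgements.IsPullback.hom_ext
    (h : S.IsPullback P X Y Z fst snd f g) (hl : S.IsMor Λ P l) (hl' : S.IsMor Λ P l') (e₁ : S.EqMor Λ X (comp fst l) (comp fst l'))
    (e₂ : S.EqMor Λ Y (comp snd l) (comp snd l')) : S.EqMor Λ P l l' := by
  have e := eqMor_comp_right h.comm hl
  simp only [comp_assoc] at e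
  obtain ⟨m, -, -, -, hm⟩ := h.exists_lift Λ _ _ (isMor_comp h.isMor_fst hl)
    (isMor_comp h.isMor_snd hl) e
  exact eqMor_trans (hm l hl (eqMor_refl (eqMor_left e₁)) (eqMor_refl (eqMor_left e₂)))
    (eqMor_symm (hm l' hl' (eqMor_symm e₁) (eqMor_symm e₂)))

/-- A cone that is a retract of a pullback cone is a pullback cone. -/
theorem _root_.TwoDimTT.Judgements.IsPullback.of_retract (h : S.IsPullback P X Y Z fst snd f g)
    (hfst : S.IsMor P' X fst') (hsnd : S.IsMor P' Y snd') (hg : S.EqMor Y Z g g')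
    (hV : S.IsMor P P' V) (hV₁ : S.EqMor P X (comp fst' V) fst)
    (hV₂ : S.EqMor P Y (comp snd' V) snd) (hW : S.IsMor P' P W)
    (hW₁ : S.EqMor P' X (comp fst W) fst') (hW₂ : S.EqMor P' Y (comp snd W) snd')
    (hVW : S.EqMor P' P' (comp V W) S.var) :
    S.IsPullback P' X Y Z fst' snd' f g' := by
  refine ⟨hfst, hsnd, h.isMor_left, eqMor_right hg, ?_, fun Λ a b ha hb e => ?_⟩
  · have e := eqMor_comp_right h.comm hW
    simp only [comp_assoc] at e
    exact eqMor_trans (eqMor_symm (eqMor_comp_left h.isMor_left hW₁))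
      (eqMor_trans e (eqMor_comp hg hW₂))
  · obtain ⟨l, hl, hla, hlb, hu⟩ := h.exists_lift Λ a b ha hb
      (eqMor_trans e (eqMor_symm (eqMor_comp_right hg hb)))
    have e₁ := eqMor_comp_right hV₁ hl
    have e₂ := eqMor_comp_right hV₂ hl
    simp only [comp_assoc] at e₁ e₂
    -- Uniqueness: `W ∘ l'` is a lift into `P`, hence equals `l`, and `l' = V ∘ W ∘ l' = V ∘ l`.
    -- Only this one composite of `V` and `W` has to be known.
    refine ⟨comp V l, isMor_comp hV hl, eqMor_trans e₁ hla, eqMor_trans e₂ hlb,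
      fun l' hl' e₁' e₂' => ?_⟩
    have w₁ := eqMor_comp_right hW₁ hl'
    have w₂ := eqMor_comp_right hW₂ hl'
    have w := eqMor_comp_right hVW hl'
    simp only [comp_assoc, var_comp] at w₁ w₂ w
    exact eqMor_trans (eqMor_symm w) (eqMor_comp_left hV
      (hu _ (isMor_comp hW hl') (eqMor_trans w₁ e₁') (eqMor_trans w₂ e₂')))

end IsPullback

/-! ### Conversion of contexts -/

variable (S) in
/-- `Γ` and `Γ'` are equal contexts: the identity vector is a morphism in both directions. -/
def CtxEq (Γ Γ' : S.Ctx) : Prop := S.IsMor Γ Γ' S.var ∧ S.IsMor Γ' Γ S.var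

namespace CtxEq

theorem symm (h : S.CtxEq Γ Γ') : S.CtxEq Γ' Γ := ⟨h.2, h.1⟩

theorem refl (h : S.IsCtx Γ) : S.CtxEq Γ Γ := ⟨isMor_var h, isMor_var h⟩

theorem isTy (h : S.CtxEq Γ Γ') (hA : S.IsTy Γ A) : S.IsTy Γ' A := by
  simpa using S.isTy_sub h.2 hA

theorem isTm (h : S.CtxEq Γ Γ') (ha : S.IsTm Γ a A) : S.IsTm Γ' a A := by
  simpa using S.isTm_sub h.2 ha

theorem eqTy (h : S.CtxEq Γ Γ') (hA : S.EqTy Γ A A') : S.EqTy Γ' A A' := by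
  simpa using S.eqTy_sub h.2 hA

theorem eqTm (h : S.CtxEq Γ Γ') (ha : S.EqTm Γ a b A) : S.EqTm Γ' a b A := by
  simpa using S.eqTm_sub h.2 ha

theorem isMor_cons (h : S.IsMor Γ Γ' S.var) (hA : S.EqTy Γ A A') (hA' : S.IsTy Γ' A') :
    S.IsMor (A :: Γ) (A' :: Γ') S.var := by
  have hw := isMor_wk (S.eqTy_left hA)
  refine ⟨?_, hA', ?_⟩
  · simpa using isMor_comp h hw
  · simpa using S.isTm_conv (isTm_var_zero (S.eqTy_left hA)) (S.eqTy_sub hw hA)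

theorem cons (h : S.CtxEq Γ Γ') (hA : S.EqTy Γ A A') : S.CtxEq (A :: Γ) (A' :: Γ') :=
  ⟨isMor_cons h.1 hA (h.isTy (eqTy_right hA)),
    isMor_cons h.2 (h.eqTy (S.eqTy_symm hA)) (S.eqTy_left hA)⟩

theorem append (h : S.CtxEq Γ Γ') {Θ : List S.Ty} (hΘ : S.IsCtx (Θ ++ Γ)) :
    S.CtxEq (Θ ++ Γ) (Θ ++ Γ') := by
  induction Θ with
  | nil => exact h
  | cons A Θ ih => exact (ih hΘ.1).cons (S.eqTy_refl hΘ.2)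

end CtxEq

end TypeTheory

/-! ### Identity contexts are well formed -/

namespace DiscreteIdTypes

open TypeTheory IdOps

variable {S : TypeTheory.{u, v}} (I : DiscreteIdTypes S)

/-- Elimination and computation over the identity context of `Φ`. -/
def HasElim (Φ : S.Ctx) : Prop :=
  ∀ (Θ : List S.Ty) (C : S.Ty) (d : S.Tm), S.IsTy (Θ ++ I.idCtx Φ) C →
    S.IsTm (subTele (I.reflCtx Φ) Θ ++ Φ) d (S.subTy (upN Θ.length (I.reflCtx Φ)) C) →
    S.IsTm (Θ ++ I.idCtx Φ) (I.JCtx Φ Θ C d) C ∧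
    S.EqTm (subTele (I.reflCtx Φ) Θ ++ Φ)
      (S.subTm (upN Θ.length (I.reflCtx Φ)) (I.JCtx Φ Θ C d)) d
      (S.subTy (upN Θ.length (I.reflCtx Φ)) C)

/-- The identity context of `Φ` is well formed, with its structure maps and elimination rule. -/
structure IdCtxRules (Φ : S.Ctx) : Prop where
  isMor_src : S.IsMor (I.idCtx Φ) Φ (src Φ)
  isMor_tgt : S.IsMor (I.idCtx Φ) Φ (tgt Φ)
  isMor_refl : S.IsMor Φ (I.idCtx Φ) (I.reflCtx Φ)
  src_refl : S.EqMor Φ Φ (comp (src Φ) (I.reflCtx Φ)) S.var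
  tgt_refl : S.EqMor Φ Φ (comp (tgt Φ) (I.reflCtx Φ)) S.var
  elim : I.HasElim Φ

/-- The rules for transport of elements of `D` along identity contexts. -/
structure TransportRules (Λ : S.Ctx) (D : S.Ty) : Prop where
  isTm : S.IsTm (S.subTy (tgt Λ) D :: I.idCtx Λ) (I.transport Λ D)
    (S.subTy S.wk (S.subTy (src Λ) D))
  refl : S.EqTm (D :: Λ) (S.subTm (up (I.reflCtx Λ)) (I.transport Λ D)) (S.var 0) (S.subTy S.wk D)

variable {I} {Λ : S.Ctx} {D : S.Ty}

theorem isTy_idStep {t : S.Tm} (h : I.IdCtxRules Λ) (hD : S.IsTy Λ D)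
    (ht : S.IsTm (S.subTy (tgt Λ) D :: I.idCtx Λ) t (S.subTy S.wk (S.subTy (src Λ) D))) :
    S.IsCtx (I.idStep D Λ t ++ I.idCtx Λ) := by
  have h1 := S.isTy_sub h.isMor_src hD
  have h2 := S.isTy_sub h.isMor_tgt hD
  have w1 := isMor_wk h1
  have h3 := S.isTy_sub w1 h2
  have w2 := isMor_wk h3
  refine ⟨⟨⟨isMor_dom h.isMor_src, h1⟩, h3⟩, I.isTy_Id ?_ ?_⟩
  · simpa using S.isTm_sub w2 (isTm_var_zero h1)
  · have := S.isTm_sub (isMor_up w1 h2) ht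
    simpa [up_eq] using this

theorem IdCtxRules.transport (h : I.IdCtxRules Λ) (hD : S.IsTy Λ D) : I.TransportRules Λ D := by
  have h1 := S.isTy_sub h.isMor_src hD
  have h2 := S.isTy_sub h.isMor_tgt hD
  have hΛ := S.isCtx_of_isTy hD
  have e1 := S.eqTy_sub_congr h.src_refl hD
  have e2 := S.eqTy_sub_congr h.tgt_refl hD
  simp only [subTy_id'] at e1 e2
  have hw := isMor_wk hD
  have e3 := S.eqTy_sub hw e1
  -- Source and target of reflexivity are the identity only up to definitional equality, so the
  -- context in which the elimination data live must be converted.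
  have hc : S.CtxEq (D :: Λ) (subTele (I.reflCtx Λ) [S.subTy (tgt Λ) D] ++ Λ) := by
    simpa [subTele] using (CtxEq.refl hΛ).cons (S.eqTy_symm e2)
  have hv := S.isTm_conv (isTm_var_zero hD) (S.eqTy_symm e3)
  have := h.elim [S.subTy (tgt Λ) D] (S.subTy S.wk (S.subTy (src Λ) D)) (S.var 0)
    (S.isTy_sub (isMor_wk h2) h1) (hc.isTm (by simpa [upN_one, up_eq] using hv))
  exact ⟨this.1, S.eqTm_conv (hc.symm.eqTm this.2) (by simpa [upN_one, up_eq] using e3)⟩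

theorem subTele_idStep (D : S.Ty) (Λ : S.Ctx) (t : S.Tm) (σ : S.Sub) :
    subTele σ (I.idStep D Λ t) =
      [I.Id (S.subTy S.wk (S.subTy S.wk (S.subTy (comp (src Λ) σ) D))) (S.var 1)
          (S.subTm (up S.wk) (S.subTm (up σ) t)),
        S.subTy S.wk (S.subTy (comp (tgt Λ) σ) D), S.subTy (comp (src Λ) σ) D] := by
  simp [subTele, idStep, up_eq, upN_one, upN_two, I.Id_sub]

/-- Where the transport term `t` is the identity, a telescope of heterogeneous identity proofs is
the ordinary path telescope, to which `J` applies. -/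
theorem ctxEq_path {Γ : S.Ctx} {A A₁ A₂ : S.Ty} {t : S.Tm} (e₁ : S.EqTy Γ A₁ A)
    (e₂ : S.EqTy Γ A₂ A) (e : S.EqTm (A :: Γ) t (S.var 0) (S.subTy S.wk A)) :
    S.CtxEq ([I.Id (S.subTy S.wk (S.subTy S.wk A₁)) (S.var 1) (S.subTm (up S.wk) t),
      S.subTy S.wk A₂, A₁] ++ Γ) (I.path A ++ Γ) := by
  have hA := eqTy_right e₁
  have w1 := isMor_wk hA
  have w2 := isMor_wk (S.isTy_sub w1 hA)
  have v3 := S.isTm_sub w2 (isTm_var_zero hA)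
  have e3 := S.eqTy_sub w2 (S.eqTy_sub w1 e₁)
  have e4 := S.eqTm_sub (isMor_up w1 hA) e
  have hc := ((CtxEq.refl (S.isCtx_of_isTy hA)).cons (S.eqTy_symm e₁)).cons
    (S.eqTy_sub w1 (S.eqTy_symm e₂))
  simp only [subTy_subTy, wk_eq, up_eq, comp_init, var_comp, subTm_var', init_snoc, snoc_zero,
    init_apply] at *
  have key := hc.symm.cons (hc.eqTy (I.eqTy_Id e3
    (S.eqTm_conv (S.eqTm_refl v3) (S.eqTy_symm e3)) (S.eqTm_conv e4 (S.eqTy_symm e3))))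
  simpa [path] using key

theorem ctxEq_subTele_refl (h : I.IdCtxRules Λ) (hD : S.IsTy Λ D) :
    S.CtxEq (subTele (I.reflCtx Λ) (I.idStep D Λ (I.transport Λ D)) ++ Λ) (I.path D ++ Λ) := by
  have e1 := S.eqTy_sub_congr h.src_refl hD
  have e2 := S.eqTy_sub_congr h.tgt_refl hD
  rw [subTy_id'] at e1 e2
  rw [subTele_idStep]
  exact ctxEq_path e1 e2 (h.transport hD).refl

/-- For `σ` the reflexivity of `Λ` this factors the reflexivity of `D :: Λ` into the diagonal of `D`
followed by the reflexivity of `Λ` under three binders. -/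
theorem diag_eq (σ : S.Sub) (D : S.Ty) :
    comp (upN 3 σ) (I.diag D) =
      snoc (snoc (snoc (comp σ S.wk) (S.var 0)) (S.var 0)) (I.r (S.subTy S.wk D) (S.var 0)) := by
  simp [upN_three, up_eq, diag]

theorem isMor_diag (hD : S.IsTy Λ D) : S.IsMor (D :: Λ) (I.path D ++ Λ) (I.diag D) := by
  have w1 := isMor_wk hD
  have v1 := isTm_var_zero hD
  have hwD := S.isTy_sub w1 hD
  have w2 := isMor_wk hwD
  have hI := I.isTy_Id (S.isTm_sub w2 v1) (isTm_var_zero hwD)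
  simp only [subTm_var', wk_eq, init_apply] at hI
  refine isMor_snoc (isMor_snoc (isMor_snoc w1 hD v1) hwD ?_) hI ?_
  · simpa using v1
  · simpa [I.Id_sub] using I.isTm_r v1

/-- The three entries for `D` join the postcontext of the elimination over `Λ`. What remains is the
case of reflexivity in `Λ`, where they form a path telescope and `J` finishes. -/
theorem HasElim.cons (h : I.IdCtxRules Λ) (hD : S.IsTy Λ D) : I.HasElim (D :: Λ) := by
  intro Θ C d hC hd
  have hE := isTy_idStep h hD (h.transport hD).isTm
  have hc := ctxEq_subTele_refl h hD
  have hρ : I.reflCtx (D :: Λ) = comp (upN 3 (I.reflCtx Λ)) (I.diag D) := (diag_eq _ _).symm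
  rw [hρ] at hd ⊢
  generalize hEdef : I.idStep D Λ (I.transport Λ D) = E at *
  have hlen : E.length = 3 := by rw [← hEdef]; rfl
  have hC0 : S.IsTy ((Θ ++ E) ++ I.idCtx Λ) C := by
    rw [List.append_assoc, ← hEdef]; exact hC
  have hu := isMor_upN h.isMor_refl (S.isCtx_of_isTy hC0)
  have hC1 := S.isTy_sub hu hC0
  have hsub : subTele (I.reflCtx Λ) (Θ ++ E) ++ Λ =
      subTele (upN 3 (I.reflCtx Λ)) Θ ++ (subTele (I.reflCtx Λ) E ++ Λ) := by
    rw [subTele_append, hlen, List.append_assoc]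
  have hup : upN (Θ ++ E).length (I.reflCtx Λ) = upN Θ.length (upN 3 (I.reflCtx Λ)) := by
    rw [List.length_append, hlen, upN_add]
  rw [hsub, hup] at hC1
  have hc' := hc.append (S.isCtx_of_isTy hC1)
  have hC2 := hc'.isTy hC1
  rw [← subTele_subTele] at hd ⊢
  have hd' : S.IsTm (subTele (I.diag D) (subTele (upN 3 (I.reflCtx Λ)) Θ) ++ D :: Λ) d
      (S.subTy (upN (subTele (upN 3 (I.reflCtx Λ)) Θ).length (I.diag D))
        (S.subTy (upN Θ.length (upN 3 (I.reflCtx Λ))) C)) := by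
    simpa [upN_comp] using hd
  have hJ := I.isTm_J hD hC2 hd'
  have hJc := I.J_comp hD hC2 hd'
  have hJ' := hc'.symm.isTm hJ
  have ih := h.elim (Θ ++ E) C (I.J D (subTele (upN 3 (I.reflCtx Λ)) Θ)
    (S.subTy (upN Θ.length (upN 3 (I.reflCtx Λ))) C) d) hC0 (by rw [hsub, hup]; exact hJ')
  have hdef : I.JCtx (D :: Λ) Θ C d = I.JCtx Λ (Θ ++ E) C
      (I.J D (subTele (upN 3 (I.reflCtx Λ)) Θ)
        (S.subTy (upN Θ.length (upN 3 (I.reflCtx Λ))) C) d) := by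
    rw [← hEdef]; rfl
  rw [← hdef] at ih
  constructor
  · have := ih.1
    rw [List.append_assoc, ← hEdef] at this
    exact this
  · have h2 := ih.2
    rw [hsub, hup] at h2
    -- The computation rule over `Λ`, restricted along the diagonal of `D`, is followed by the
    -- computation rule of `J`.
    have h3 := S.eqTm_trans (S.eqTm_sub (isMor_upN (isMor_diag hD) (S.isCtx_of_isTy hC2))
      (hc'.eqTm h2)) hJc
    simpa [upN_comp] using h3

theorem IdCtxRules.cons (h : I.IdCtxRules Λ) (hD : S.IsTy Λ D) : I.IdCtxRules (D :: Λ) := by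
  have ht := (h.transport hD).isTm
  have hE := isTy_idStep h hD ht
  have h1 := S.isTy_sub h.isMor_src hD
  have h2 := S.isTy_sub h.isMor_tgt hD
  have w1 := isMor_wk h1
  have h3 := S.isTy_sub w1 h2
  have w2 := isMor_wk h3
  have w3 : S.IsMor (I.idCtx (D :: Λ)) _ S.wk := isMor_wk hE.2
  have w := isMor_comp (isMor_comp w1 w2) w3
  have v1 := S.isTm_sub w3 (S.isTm_sub w2 (isTm_var_zero h1))
  have v2 := S.isTm_sub w3 (isTm_var_zero h3)
  have hr : S.IsMor (D :: Λ) (I.idCtx (D :: Λ)) (I.reflCtx (D :: Λ)) := by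
    have := isMor_comp (isMor_upN (Θ := I.idStep D Λ (I.transport Λ D)) h.isMor_refl hE)
      (isMor_comp (ctxEq_subTele_refl h hD).2 (isMor_diag hD))
    rw [var_comp] at this
    have e : I.reflCtx (D :: Λ) = comp (upN 3 (I.reflCtx Λ)) (I.diag D) := (diag_eq _ _).symm
    rw [e]
    exact this
  have v0 := S.eqTm_refl (isTm_var_zero hD)
  have e1 := eqMor_comp_right h.src_refl (isMor_wk hD)
  have e2 := eqMor_comp_right h.tgt_refl (isMor_wk hD)
  have c1 := S.eqTy_sub_congr (eqMor_symm e1) hD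
  have c2 := S.eqTy_sub_congr (eqMor_symm e2) hD
  refine ⟨isMor_snoc ?_ hD ?_, isMor_snoc ?_ hD ?_, hr, ?_, ?_, HasElim.cons h hD⟩
  · simpa using isMor_comp h.isMor_src w
  · simpa using v1
  · simpa using isMor_comp h.isMor_tgt w
  · simpa using v2
  · refine ⟨by simpa [src, reflCtx] using e1, hD, ?_⟩
    simpa [src, reflCtx] using S.eqTm_conv v0 (by simpa using c1)
  · refine ⟨by simpa [tgt, reflCtx] using e2, hD, ?_⟩
    simpa [tgt, reflCtx] using S.eqTm_conv v0 (by simpa using c2)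

theorem idCtxRules {Φ : S.Ctx} (hΦ : S.IsCtx Φ) : I.IdCtxRules Φ := by
  induction Φ with
  | nil =>
    refine ⟨trivial, trivial, trivial, trivial, trivial, fun Θ C d _ hd => ?_⟩
    simp only [reflCtx, subTele_var, upN_var, subTy_id', subTm_id'] at hd ⊢
    exact ⟨hd, S.eqTm_refl hd⟩
  | cons D Λ ih => exact (ih hΦ.1).cons hΦ.2

end DiscreteIdTypes

/-! ### Eliminating along a morphism of contexts -/

namespace TypeTheory

variable {S : TypeTheory.{u, v}} {Φ Ψ Ω : S.Ctx} {ρ ρ' : S.Sub}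

variable (S) in
/-- Terms over `Ψ` (and a postcontext) can be defined by prescribing them along `ρ : Φ → Ψ`. -/
def ElimAlong (Φ Ψ : S.Ctx) (ρ : S.Sub) : Prop :=
  ∀ (Θ : List S.Ty) (C : S.Ty) (d : S.Tm), S.IsTy (Θ ++ Ψ) C →
    S.IsTm (subTele ρ Θ ++ Φ) d (S.subTy (upN Θ.length ρ) C) →
    ∃ j, S.IsTm (Θ ++ Ψ) j C ∧
      S.EqTm (subTele ρ Θ ++ Φ) (S.subTm (upN Θ.length ρ) j) d (S.subTy (upN Θ.length ρ) C)

theorem CtxEq.elimAlong (h : S.CtxEq Φ Ψ) : S.ElimAlong Φ Ψ S.var := by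
  intro Θ C d hC hd
  simp only [subTele_var, upN_var, subTy_id', subTm_id'] at hd ⊢
  have hc := h.symm.append (S.isCtx_of_isTy hC)
  exact ⟨d, hc.symm.isTm hd, S.eqTm_refl hd⟩

/-- Extend along `ρ'` over the postcontext restricted to `Ψ`, then extend the result along `ρ`. -/
theorem ElimAlong.comp (h : S.ElimAlong Ψ Ω ρ) (hρ : S.IsMor Ψ Ω ρ) (h' : S.ElimAlong Φ Ψ ρ')
    (hρ' : S.IsMor Φ Ψ ρ') : S.ElimAlong Φ Ω (RawExpr.comp ρ ρ') := by
  intro Θ C d hC hd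
  have hC' := S.isTy_sub (isMor_upN hρ (S.isCtx_of_isTy hC)) hC
  have hu := isMor_upN hρ' (S.isCtx_of_isTy hC')
  simp only [← subTele_subTele, ← upN_comp, ← subTy_subTy, ← subTm_subTm] at hd ⊢
  obtain ⟨j, hj, hjd⟩ := h' (subTele ρ Θ) _ d hC' (by simpa using hd)
  obtain ⟨k, hk, hkj⟩ := h Θ C j hC hj
  have := S.eqTm_trans (S.eqTm_sub hu hkj) hjd
  exact ⟨k, hk, by simpa using this⟩

/-- `E` is absorbed into the postcontext; this is where arbitrary postcontexts are indispensable. -/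
theorem ElimAlong.upN (h : S.ElimAlong Φ Ψ ρ) (E : List S.Ty) :
    S.ElimAlong (subTele ρ E ++ Φ) (E ++ Ψ) (upN E.length ρ) := by
  intro Θ C d hC hd
  have := h (Θ ++ E) C d (by rwa [List.append_assoc])
    (by rwa [subTele_append, List.append_assoc, List.length_append, upN_add])
  rwa [subTele_append, List.append_assoc, List.length_append, upN_add, List.append_assoc] at this

end TypeTheory

namespace DiscreteIdTypes

open TypeTheory IdOps

variable {S : TypeTheory.{u, v}} {I : DiscreteIdTypes S} {Γ Δ Λ Φ Ψ Ξ : S.Ctx} {D A : S.Ty}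
  {f ρ L L' N N' : S.Sub} {x x' y y' q q' : S.Tm}

theorem elimAlong_diag (hD : S.IsTy Λ D) : S.ElimAlong (D :: Λ) (I.path D ++ Λ) (I.diag D) :=
  fun _ _ _ hC hd => ⟨_, I.isTm_J hD hC hd, I.J_comp hD hC hd⟩

theorem IdCtxRules.elimAlong (h : I.IdCtxRules Φ) : S.ElimAlong Φ (I.idCtx Φ) (I.reflCtx Φ) :=
  fun Θ C d hC hd => ⟨_, h.elim Θ C d hC hd⟩

/-- Terms of a discrete identity type are determined by their values along `ρ`. -/
theorem eqTm_of_elimAlong {a b s t : S.Tm} (h : S.ElimAlong Φ Ψ ρ)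
    (hs : S.IsTm Ψ s (I.Id A a b)) (ht : S.IsTm Ψ t (I.Id A a b))
    (e : S.EqTm Φ (S.subTm ρ s) (S.subTm ρ t) (S.subTy ρ (I.Id A a b))) :
    S.EqTm Ψ s t (I.Id A a b) := by
  -- Along `ρ` the two terms agree, so reflexivity inhabits the identity type between them;
  -- elimination extends this to `Ψ`, and discreteness applies there.
  have hd := S.isTm_conv (I.isTm_r (S.eqTm_left e))
    (I.eqTy_Id (S.eqTy_refl (S.isTy_of_isTm (S.eqTm_left e))) (S.eqTm_refl (S.eqTm_left e)) e)
  obtain ⟨j, hj, -⟩ := h [] (I.Id (I.Id A a b) s t) _ (I.isTy_Id hs ht)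
    (by simpa [I.Id_sub] using hd)
  exact I.disc hs ht hj

/-! ### Morphisms into identity contexts -/

theorem isMor_idCtx_cons (h : I.IdCtxRules Λ) (hD : S.IsTy Λ D) :
    S.IsMor Ξ (I.idCtx (D :: Λ)) (snoc (snoc (snoc L x) y) q) ↔
      S.IsMor Ξ (I.idCtx Λ) L ∧ S.IsTm Ξ x (S.subTy (comp (src Λ) L) D) ∧
      S.IsTm Ξ y (S.subTy (comp (tgt Λ) L) D) ∧
      S.IsTm Ξ q (I.Id (S.subTy (comp (src Λ) L) D) x
        (S.subTm (snoc L y) (I.transport Λ D))) := by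
  have hE := isTy_idStep h hD (h.transport hD).isTm
  have key : S.IsMor Ξ (I.idCtx (D :: Λ)) (snoc (snoc (snoc L x) y) q) ↔
    ((S.IsMor Ξ (I.idCtx Λ) L ∧ _ ∧ _) ∧ _ ∧ _) ∧ _ ∧ _ := Iff.rfl
  have h1 := hE.1.1.2
  have h2 := hE.1.2
  have h3 := hE.2
  simp [I.Id_sub, up_eq] at key h1 h2 h3
  rw [key]
  tauto

theorem eqMor_idCtx_cons (h : I.IdCtxRules Λ) (hD : S.IsTy Λ D) :
    S.EqMor Ξ (I.idCtx (D :: Λ)) (snoc (snoc (snoc L x) y) q) (snoc (snoc (snoc L' x') y') q') ↔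
      S.EqMor Ξ (I.idCtx Λ) L L' ∧ S.EqTm Ξ x x' (S.subTy (comp (src Λ) L) D) ∧
      S.EqTm Ξ y y' (S.subTy (comp (tgt Λ) L) D) ∧
      S.EqTm Ξ q q' (I.Id (S.subTy (comp (src Λ) L) D) x
        (S.subTm (snoc L y) (I.transport Λ D))) := by
  have hE := isTy_idStep h hD (h.transport hD).isTm
  have key : S.EqMor Ξ (I.idCtx (D :: Λ)) (snoc (snoc (snoc L x) y) q)
      (snoc (snoc (snoc L' x') y') q') ↔
    ((S.EqMor Ξ (I.idCtx Λ) L L' ∧ _ ∧ _) ∧ _ ∧ _) ∧ _ ∧ _ := Iff.rfl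
  have h1 := hE.1.1.2
  have h2 := hE.1.2
  have h3 := hE.2
  simp [I.Id_sub, up_eq] at key h1 h2 h3
  rw [key]
  tauto

end DiscreteIdTypes

namespace DiscreteIdTypes

open TypeTheory IdOps

variable {S : TypeTheory.{u, v}} {I : DiscreteIdTypes S} {Γ Δ Λ Φ Ψ Ξ : S.Ctx} {D A : S.Ty}
  {f ρ L L' N N' : S.Sub} {x x' y y' q q' : S.Tm}

theorem snoc_eta_three (σ : S.Sub) :
    σ = snoc (snoc (snoc (init (init (init σ))) (σ 2)) (σ 1)) (σ 0) := by simp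

/-- Morphisms into an identity context are determined by their source, their target and their
values along `ρ`. -/
theorem eqMor_of_elimAlong (hΔ : S.IsCtx Δ) (h : S.ElimAlong Φ Ψ ρ)
    (hN : S.IsMor Ψ (I.idCtx Δ) N) (hN' : S.IsMor Ψ (I.idCtx Δ) N')
    (hs : S.EqMor Ψ Δ (comp (src Δ) N) (comp (src Δ) N'))
    (ht : S.EqMor Ψ Δ (comp (tgt Δ) N) (comp (tgt Δ) N'))
    (hr : S.EqMor Φ (I.idCtx Δ) (comp N ρ) (comp N' ρ)) :
    S.EqMor Ψ (I.idCtx Δ) N N' := by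
  induction Δ generalizing N N' with
  | nil => exact isMor_dom hN
  | cons D Λ ih =>
    have hΛ := idCtxRules (I := I) hΔ.1
    obtain ⟨L, x, y, q, rfl⟩ : ∃ L x y q, N = snoc (snoc (snoc L x) y) q :=
      ⟨_, _, _, _, snoc_eta_three N⟩
    obtain ⟨L', x', y', q', rfl⟩ : ∃ L x y q, N' = snoc (snoc (snoc L x) y) q :=
      ⟨_, _, _, _, snoc_eta_three N'⟩
    have hs0 := hs.2.2
    have ht0 := ht.2.2
    have hs1 := hs.1
    have ht1 := ht.1
    simp only [src, tgt, comp_snoc, comp_assoc, snoc_zero, init_snoc, wk_eq, comp_init, var_comp,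
      subTm_var', snoc_two, snoc_one] at hs0 ht0 hs1 ht1
    rw [isMor_idCtx_cons hΛ hΔ.2] at hN hN'
    simp only [comp_snoc, eqMor_idCtx_cons hΛ hΔ.2] at hr
    obtain ⟨hL, hx, hy, hq⟩ := hN
    obtain ⟨hL', hx', hy', hq'⟩ := hN'
    have e := ih hΔ.1 hL hL' hs1 ht1 hr.1
    -- The types of `q` and `q'` contain transports along `L` and `L'`, so they can be identified
    -- only after the inductive equality `e`.
    have hty : S.EqTy Ψ (I.Id (S.subTy (comp (src Λ) L) D) x
        (S.subTm (snoc L y) (I.transport Λ D))) (I.Id (S.subTy (comp (src Λ) L') D) x'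
        (S.subTm (snoc L' y') (I.transport Λ D))) := by
      refine I.eqTy_Id (S.eqTy_sub_congr hs1 hΔ.2) hs0 ?_
      have := S.eqTm_sub_congr (eqMor_snoc e (S.isTy_sub hΛ.isMor_tgt hΔ.2) (by simpa using ht0))
        (hΛ.transport hΔ.2).isTm
      simpa using this
    refine (eqMor_idCtx_cons hΛ hΔ.2).2 ⟨e, hs0, ht0, ?_⟩
    refine eqTm_of_elimAlong h hq (S.isTm_conv hq' (S.eqTy_symm hty)) ?_
    simpa [I.Id_sub] using hr.2.2.2

/-! ### Lifting morphisms to identity contexts -/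

/-- `lift Γ Δ f` is the morphism of identity contexts lying over `f` and preserving
reflexivities. -/
structure LiftRules (I : DiscreteIdTypes S) (Γ Δ : S.Ctx) (f N : S.Sub) : Prop where
  isMor : S.IsMor (I.idCtx Γ) (I.idCtx Δ) N
  src : S.EqMor (I.idCtx Γ) Δ (comp (src Δ) N) (comp f (src Γ))
  tgt : S.EqMor (I.idCtx Γ) Δ (comp (tgt Δ) N) (comp f (tgt Γ))
  refl : S.EqMor Γ (I.idCtx Δ) (comp N (I.reflCtx Γ)) (comp (I.reflCtx Δ) f)

/-- Source, target and values at reflexivities are all prescribed. Functoriality of lifting follows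
from this without computing any eliminator. -/
theorem LiftRules.unique (h : LiftRules I Γ Δ f N) (h' : LiftRules I Γ Δ f N')
    (hΓ : S.IsCtx Γ) (hΔ : S.IsCtx Δ) : S.EqMor (I.idCtx Γ) (I.idCtx Δ) N N' :=
  have hI := idCtxRules (I := I) hΓ
  eqMor_of_elimAlong hΔ hI.elimAlong h.isMor h'.isMor
    (eqMor_trans h.src (eqMor_symm h'.src)) (eqMor_trans h.tgt (eqMor_symm h'.tgt))
    (eqMor_trans h.refl (eqMor_symm h'.refl))

theorem LiftRules.comp {g M : S.Sub} (h' : LiftRules I Δ Λ g M) (hg : S.IsMor Δ Λ g)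
    (h : LiftRules I Γ Δ f N) (hf : S.IsMor Γ Δ f) :
    LiftRules I Γ Λ (RawExpr.comp g f) (RawExpr.comp M N) := by
  refine ⟨isMor_comp h'.isMor h.isMor, ?_, ?_, ?_⟩
  · have e := eqMor_trans (eqMor_comp_right h'.src h.isMor)
      (by simpa using eqMor_comp_left hg h.src)
    simpa using e
  · have e := eqMor_trans (eqMor_comp_right h'.tgt h.isMor)
      (by simpa using eqMor_comp_left hg h.tgt)
    simpa using e
  · have e := eqMor_trans (eqMor_comp_left h'.isMor h.refl)
      (by simpa using eqMor_comp_right h'.refl hf)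
    simpa using e

theorem liftRules (hΓ : S.IsCtx Γ) (hf : S.IsMor Γ Δ f) :
    LiftRules I Γ Δ f (I.lift Γ Δ f) := by
  have hI := idCtxRules (I := I) hΓ
  induction Δ generalizing f with
  | nil => exact ⟨isMor_dom hI.isMor_src, isMor_dom hI.isMor_src, isMor_dom hI.isMor_src, hΓ⟩
  | cons D Λ ih =>
    obtain ⟨g, a, rfl⟩ : ∃ g a, f = snoc g a := ⟨_, _, (snoc_eta f).symm⟩
    obtain ⟨hg, hD, ha⟩ := hf
    simp only [init_snoc, snoc_zero] at hg ha
    have hL := ih hg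
    have hΛ := idCtxRules (I := I) (isMor_cod hg)
    have hT := hΛ.transport hD
    have hDt := S.isTy_sub hΛ.isMor_tgt hD
    have es := S.eqTy_sub_congr hL.src hD
    have et := S.eqTy_sub_congr hL.tgt hD
    have hx := S.isTm_sub hI.isMor_src ha
    have hy := S.isTm_sub hI.isMor_tgt ha
    rw [subTy_subTy] at hx hy
    have hx' := S.isTm_conv hx (S.eqTy_symm es)
    have hy' := S.isTm_conv hy (S.eqTy_symm et)
    have hLy := isMor_snoc hL.isMor hDt (by simpa using hy')
    have hz : S.IsTm (I.idCtx Γ) (S.subTm (snoc (I.lift Γ Λ g) (S.subTm (tgt Γ) a))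
        (I.transport Λ D)) (S.subTy (comp (src Λ) (I.lift Γ Λ g)) D) := by
      simpa using S.isTm_sub hLy hT.isTm
    have hC := I.isTy_Id hx (S.isTm_conv hz es)
    have esr : S.EqMor Γ Λ (comp g (comp (src Γ) (I.reflCtx Γ))) g := by
      simpa using eqMor_comp_left hg hI.src_refl
    have eD := S.eqTy_sub_congr esr hD
    have eax := S.eqTm_sub_congr hI.src_refl ha
    have eay := S.eqTm_sub_congr hI.tgt_refl ha
    have etr := S.eqTy_sub hI.isMor_refl et
    have esr' := S.eqTy_sub hI.isMor_refl es
    simp only [subTy_subTy, comp_assoc, subTm_id'] at etr esr' eax eay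
    have eLy : S.EqMor Γ (S.subTy (tgt Λ) D :: I.idCtx Λ)
        (comp (snoc (I.lift Γ Λ g) (S.subTm (tgt Γ) a)) (I.reflCtx Γ))
        (comp (up (I.reflCtx Λ)) (snoc g a)) := by
      simpa [up_eq] using eqMor_snoc hL.refl hDt (by simpa using S.eqTm_conv eay (S.eqTy_symm etr))
    have ez := S.eqTm_sub_congr eLy hT.isTm
    have ez' := S.eqTm_sub (isMor_snoc hg hD ha) hT.refl
    simp only [subTy_subTy, subTm_subTm, comp_assoc, wk_eq, comp_init, var_comp, subTm_var',
      init_snoc, snoc_zero, comp_snoc] at ez ez'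
    -- At reflexivity the transported endpoint becomes `r(g x)^* a = a`, so `r(a)` has the type
    -- required by the elimination.
    have ez'' := S.eqTm_trans (S.eqTm_conv ez (S.eqTy_trans esr' eD)) ez'
    have eC := I.eqTy_Id (S.eqTy_symm eD) (S.eqTm_conv (S.eqTm_symm eax) eD) (S.eqTm_symm ez'')
    obtain ⟨hq, hqr⟩ := hI.elim [] _ (I.r (S.subTy g D) a) hC
      (by simpa [I.Id_sub] using S.isTm_conv (I.isTm_r ha) eC)
    -- The eliminator is typed over `g ∘ src`, the identity context over `src` of the lift; `es`
    -- identifies the two.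
    have hC' := I.eqTy_Id es (S.eqTm_refl hx') (S.eqTm_refl hz)
    have hq' := S.isTm_conv hq (S.eqTy_symm hC')
    have hC'' := S.eqTy_sub hI.isMor_refl (S.eqTy_symm hC')
    refine ⟨(isMor_idCtx_cons hΛ hD).2 ⟨hL.isMor, hx', hy', hq'⟩, ?_, ?_, ?_⟩
    · simpa [IdOps.src, IdOps.lift] using eqMor_snoc hL.src hD (by simpa using S.eqTm_refl hx')
    · simpa [IdOps.tgt, IdOps.lift] using eqMor_snoc hL.tgt hD (by simpa using S.eqTm_refl hy')
    · have key := (eqMor_idCtx_cons hΛ hD).2 ⟨hL.refl,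
        S.eqTm_conv eax (S.eqTy_symm esr'), S.eqTm_conv eay (S.eqTy_symm etr),
        by simpa [I.Id_sub] using S.eqTm_conv hqr hC''⟩
      simpa [reflCtx, IdOps.lift, I.r_sub] using key

end DiscreteIdTypes

/-! ### Reduction of 2-pullbacks to pullbacks of identity contexts -/

namespace DiscreteIdTypes

open TypeTheory IdOps

variable {S : TypeTheory.{u, v}} {I : DiscreteIdTypes S}

/-- A pullback square that is sent to a pullback square of identity contexts is a
2-pullback. -/
theorem isTwoPullback_of_isPullback_idCtx {P X Y Z : S.Ctx} {fst snd f g : S.Sub}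
    (h : S.IsPullback P X Y Z fst snd f g)
    (hI : S.IsPullback (I.idCtx P) (I.idCtx X) (I.idCtx Y) (I.idCtx Z) (I.lift P X fst)
      (I.lift P Y snd) (I.lift X Z f) (I.lift Y Z g)) :
    I.IsTwoPullback P X Y Z fst snd f g := by
  refine ⟨h, fun Λ a b α β ha hb hα hβ e => ?_⟩
  have hP := isMor_dom h.isMor_fst
  have R := idCtxRules (I := I) hP
  have L₁ := liftRules (I := I) hP h.isMor_fst
  have L₂ := liftRules (I := I) hP h.isMor_snd
  have RX := idCtxRules (I := I) (isMor_cod h.isMor_fst)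
  have RY := idCtxRules (I := I) (isMor_cod h.isMor_snd)
  obtain ⟨γ, hγ, e₁, e₂, hu⟩ := hI.exists_lift Λ α β hα.1 hβ.1 e
  -- The endpoints of `γ` are identified with `a` and `b` by the original pullback, since both
  -- projections carry them to the endpoints of `α` and `β`.
  refine ⟨γ, ⟨hγ, h.hom_ext (isMor_comp R.isMor_src hγ) ha ?_ ?_,
    h.hom_ext (isMor_comp R.isMor_tgt hγ) hb ?_ ?_⟩, e₁, e₂,
    fun γ' hγ' e₁' e₂' => hu γ' hγ'.1 e₁' e₂'⟩
  · have n := eqMor_trans (eqMor_symm (eqMor_comp_right L₁.src hγ))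
      (by simpa using eqMor_comp_left RX.isMor_src e₁)
    simpa using eqMor_trans n hα.2.1
  · have n := eqMor_trans (eqMor_symm (eqMor_comp_right L₂.src hγ))
      (by simpa using eqMor_comp_left RY.isMor_src e₂)
    simpa using eqMor_trans n hβ.2.1
  · have n := eqMor_trans (eqMor_symm (eqMor_comp_right L₁.tgt hγ))
      (by simpa using eqMor_comp_left RX.isMor_tgt e₁)
    simpa using eqMor_trans n hα.2.2
  · have n := eqMor_trans (eqMor_symm (eqMor_comp_right L₂.tgt hγ))
      (by simpa using eqMor_comp_left RY.isMor_tgt e₂)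
    simpa using eqMor_trans n hβ.2.2

/-- Forgetting the last three entries of an identity context respects sources, targets and
reflexivities, so by uniqueness it is the lift of the projection. -/
theorem liftRules_wk {Γ : S.Ctx} {A : S.Ty} (hA : S.IsTy Γ A) :
    LiftRules I (A :: Γ) Γ S.wk (drop 3 S.var) := by
  have hΓ := S.isCtx_of_isTy hA
  have R := idCtxRules (I := I) hΓ
  have R' := idCtxRules (I := I) (Φ := A :: Γ) ⟨hΓ, hA⟩
  have hd : S.IsMor (I.idCtx (A :: Γ)) (I.idCtx Γ) (drop 3 S.var) :=
    isMor_drop (Θ := I.idStep A Γ (I.transport Γ A)) (isMor_dom R'.isMor_src)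
  refine ⟨hd, ?_, ?_, ?_⟩
  · simpa [src, drop_three] using eqMor_refl (isMor_comp R.isMor_src hd)
  · simpa [tgt, drop_three] using eqMor_refl (isMor_comp R.isMor_tgt hd)
  · simpa [reflCtx, drop_three] using eqMor_refl (isMor_comp hd R'.isMor_refl)

/-! ### Base change of the identity telescope along a lift -/

section BaseChange

variable {Γ Δ : S.Ctx} {f : S.Sub} {B : S.Ty}

variable (I) in
/-- The telescope `x : B(f x), y : B(f y), q : Id_B(f x)(x, (f^• p)^* y)` over `idCtx Γ`. -/
def pullbackStep (Γ Δ : S.Ctx) (f : S.Sub) (B : S.Ty) : List S.Ty :=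
  subTele (I.lift Γ Δ f) (I.idStep B Δ (I.transport Δ B))

theorem isPullback_pullbackStep (hf : S.IsMor Γ Δ f) (hB : S.IsTy Δ B) :
    S.IsPullback (I.pullbackStep Γ Δ f B ++ I.idCtx Γ) (I.idCtx Γ) (I.idCtx (B :: Δ)) (I.idCtx Δ)
      (drop 3 S.var) (upN 3 (I.lift Γ Δ f)) (I.lift Γ Δ f) (drop 3 S.var) :=
  have hΔ := idCtxRules (I := I) (isMor_cod hf)
  isPullback_subTele (liftRules (isMor_dom hf) hf).isMor
    (isTy_idStep hΔ hB (hΔ.transport hB).isTm)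

/-- At reflexivity `(f^• r(x))^* y = r(f x)^* y = y`, so the telescope becomes a path telescope by
`ctxEq_path`. -/
theorem ctxEq_subTele_pullbackStep (hf : S.IsMor Γ Δ f) (hB : S.IsTy Δ B) :
    S.CtxEq (subTele (I.reflCtx Γ) (I.pullbackStep Γ Δ f B) ++ Γ)
      (I.path (S.subTy f B) ++ Γ) := by
  have RΓ := idCtxRules (I := I) (isMor_dom hf)
  have RΔ := idCtxRules (I := I) (isMor_cod hf)
  have L := liftRules (I := I) (isMor_dom hf) hf
  have hA := S.isTy_sub hf hB
  have s := eqMor_trans (eqMor_comp_right L.src RΓ.isMor_refl)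
    (by simpa using eqMor_comp_left hf RΓ.src_refl)
  have t := eqMor_trans (eqMor_comp_right L.tgt RΓ.isMor_refl)
    (by simpa using eqMor_comp_left hf RΓ.tgt_refl)
  have es := S.eqTy_sub_congr s hB
  have et := S.eqTy_sub_congr t hB
  have w := isMor_wk hA
  have hBt := S.isTy_sub RΔ.isMor_tgt hB
  have et' := S.eqTy_sub w et
  have es' := S.eqTy_sub w es
  have hup : S.EqMor (S.subTy f B :: Γ) (S.subTy (tgt Δ) B :: I.idCtx Δ)
      (up (comp (I.lift Γ Δ f) (I.reflCtx Γ))) (comp (up (I.reflCtx Δ)) (up f)) := by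
    rw [up_comp]
    refine eqMor_snoc (eqMor_comp_right L.refl w) hBt ?_
    have v := S.eqTm_refl (isTm_var_zero hA)
    simpa using S.eqTm_conv v (S.eqTy_symm et')
  have e₁ := S.eqTm_sub_congr hup (RΔ.transport hB).isTm
  have e₂ := S.eqTm_sub (isMor_up hf hB) (RΔ.transport hB).refl
  rw [pullbackStep, subTele_subTele, subTele_idStep]
  refine ctxEq_path (by simpa using es) (by simpa using et) ?_
  have e₁' := S.eqTm_conv e₁ (by simpa [up_eq] using es')
  simpa [up_eq] using S.eqTm_trans e₁' (by simpa [up_eq] using e₂)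

/-- The reflexivity vector of `Γ.f^*B` also lands in the base-changed context, because it factors
through the diagonal of `f^*B`. Elimination along it is composed from the factors. -/
theorem elimAlong_pullbackStep (hf : S.IsMor Γ Δ f) (hB : S.IsTy Δ B) :
    S.IsMor (S.subTy f B :: Γ) (I.pullbackStep Γ Δ f B ++ I.idCtx Γ)
      (I.reflCtx (S.subTy f B :: Γ)) ∧
    S.ElimAlong (S.subTy f B :: Γ) (I.pullbackStep Γ Δ f B ++ I.idCtx Γ)
      (I.reflCtx (S.subTy f B :: Γ)) := by
  have RΓ := idCtxRules (I := I) (isMor_dom hf)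
  have hA := S.isTy_sub hf hB
  have hc := ctxEq_subTele_pullbackStep (I := I) hf hB
  have hE := isMor_dom (isPullback_pullbackStep (I := I) hf hB).isMor_fst
  have hu := isMor_upN RΓ.isMor_refl hE
  have hr : I.reflCtx (S.subTy f B :: Γ) =
      comp (upN (I.pullbackStep Γ Δ f B).length (I.reflCtx Γ))
        (comp S.var (I.diag (S.subTy f B))) := by
    rw [var_comp]
    exact (diag_eq _ _).symm
  rw [hr]
  have hd := isMor_diag (I := I) hA
  exact ⟨isMor_comp hu (isMor_comp hc.2 hd), (RΓ.elimAlong.upN _).comp hu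
    (hc.symm.elimAlong.comp hc.2 (elimAlong_diag hA) hd) (isMor_comp hc.2 hd)⟩

end BaseChange

end DiscreteIdTypes

namespace DiscreteIdTypes

open TypeTheory IdOps

variable {S : TypeTheory.{u, v}} {I : DiscreteIdTypes S}

/-! ### Comparison of the base change with the identity context of `Γ.f^*B` -/

section BaseChange

variable {Γ Δ : S.Ctx} {f : S.Sub} {B : S.Ty}

/-- Only the last entry changes: a proof `U` of `Id(x, p^* y)` is defined by elimination, with value
`r(x)` at reflexivity, where `p^* y` is `x`. -/
theorem exists_isMor_pullbackStep (hf : S.IsMor Γ Δ f) (hB : S.IsTy Δ B) :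
    ∃ U, S.IsMor (I.pullbackStep Γ Δ f B ++ I.idCtx Γ) (I.idCtx (S.subTy f B :: Γ))
        (snoc (snoc (snoc (drop 3 S.var) (S.var 2)) (S.var 1)) U) ∧
      S.EqMor (S.subTy f B :: Γ) (I.idCtx (S.subTy f B :: Γ))
        (comp (snoc (snoc (snoc (drop 3 S.var) (S.var 2)) (S.var 1)) U)
          (I.reflCtx (S.subTy f B :: Γ))) (I.reflCtx (S.subTy f B :: Γ)) := by
  have RΓ := idCtxRules (I := I) (isMor_dom hf)
  have RΔ := idCtxRules (I := I) (isMor_cod hf)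
  have L := liftRules (I := I) (isMor_dom hf) hf
  have hA := S.isTy_sub hf hB
  have RA := idCtxRules (I := I) (Φ := S.subTy f B :: Γ) ⟨isMor_dom hf, hA⟩
  have w := isMor_wk hA
  have hP := isPullback_pullbackStep (I := I) hf hB
  obtain ⟨hR, hRe⟩ := elimAlong_pullbackStep (I := I) hf hB
  have hd := hP.isMor_fst
  have hu : S.IsMor (I.pullbackStep Γ Δ f B ++ I.idCtx Γ) (I.idCtx (B :: Δ))
      (snoc (snoc (snoc (comp (I.lift Γ Δ f) (drop 3 S.var)) (S.var 2)) (S.var 1)) (S.var 0)) := by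
    simpa [upN_three, up_eq, drop_three] using hP.isMor_snd
  obtain ⟨-, h2, h1, -⟩ := (isMor_idCtx_cons RΔ hB).1 hu
  have es := S.eqTy_sub_congr (eqMor_comp_right L.src hd) hB
  have et := S.eqTy_sub_congr (eqMor_comp_right L.tgt hd) hB
  simp only [comp_assoc] at es et
  have h2' := S.isTm_conv h2 es
  have h1' := S.isTm_conv h1 et
  rw [← subTy_subTy] at h2' h1'
  have hz := S.isTm_sub (isMor_snoc hd (S.isTy_sub RΓ.isMor_tgt hA) (by simpa using h1'))
    (RΓ.transport hA).isTm
  have hC := I.isTy_Id h2' (by simpa using hz)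
  have er := S.eqTy_sub w (S.eqTy_sub_congr RΓ.src_refl hA)
  have v := isTm_var_zero hA
  have eC := I.eqTy_Id (S.eqTy_symm er) (S.eqTm_refl (by simpa using v))
    (by simpa using S.eqTm_symm (RΓ.transport hA).refl)
  have hr := S.isTm_conv (I.isTm_r v) (by simpa using eC)
  obtain ⟨U, hU, hUr⟩ := hRe [] _ (I.r (S.subTy S.wk (S.subTy f B)) (S.var 0)) hC
    (by simpa [I.Id_sub, reflCtx, drop_three, up_eq] using hr)
  refine ⟨U, (isMor_idCtx_cons RΓ hA).2 ⟨hd, by simpa using h2', by simpa using h1',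
    by simpa using hU⟩, ?_⟩
  have hRA := RA.isMor_refl
  rw [reflCtx, isMor_idCtx_cons RΓ hA] at hRA
  have key := (eqMor_idCtx_cons RΓ hA).2 ⟨eqMor_refl hRA.1, S.eqTm_refl hRA.2.1,
    S.eqTm_refl hRA.2.2.1, by simpa [I.Id_sub, reflCtx, drop_three] using hUr⟩
  simpa [reflCtx, drop_three] using key

theorem isPullback_up (hf : S.IsMor Γ Δ f) (hB : S.IsTy Δ B) :
    S.IsPullback (S.subTy f B :: Γ) Γ (B :: Δ) Δ S.wk (up f) f S.wk :=
  isPullback_subTele (Θ := [B]) hf ⟨isMor_cod hf, hB⟩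

theorem isPullback_idCtx_lift (hf : S.IsMor Γ Δ f) (hB : S.IsTy Δ B) :
    S.IsPullback (I.idCtx (S.subTy f B :: Γ)) (I.idCtx Γ) (I.idCtx (B :: Δ)) (I.idCtx Δ)
      (I.lift (S.subTy f B :: Γ) Γ S.wk) (I.lift (S.subTy f B :: Γ) (B :: Δ) (up f))
      (I.lift Γ Δ f) (I.lift (B :: Δ) Δ S.wk) := by
  have hΓ := isMor_dom hf
  have hΔ := isMor_cod hf
  have hA := S.isTy_sub hf hB
  have hΓA : S.IsCtx (S.subTy f B :: Γ) := ⟨hΓ, hA⟩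
  have hΔB : S.IsCtx (B :: Δ) := ⟨hΔ, hB⟩
  have P₁ := isPullback_up hf hB
  have P := isPullback_pullbackStep (I := I) hf hB
  have RΓ := idCtxRules (I := I) hΓ
  have RΔ := idCtxRules (I := I) hΔ
  have RA := idCtxRules (I := I) hΓA
  have RB := idCtxRules (I := I) hΔB
  have L := liftRules (I := I) hΓ hf
  have Lw := liftRules (I := I) hΓA (isMor_wk hA)
  have Lw' := liftRules (I := I) hΔB (isMor_wk hB)
  have Lu := liftRules (I := I) hΓA P₁.isMor_snd
  have ew := Lw.unique (liftRules_wk hA) hΓA hΓ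
  have ew' := Lw'.unique (liftRules_wk hB) hΔB hΔ
  obtain ⟨hR, hRe⟩ := elimAlong_pullbackStep (I := I) hf hB
  obtain ⟨U, hV, hVR⟩ := exists_isMor_pullbackStep (I := I) hf hB
  set V : S.Sub := snoc (snoc (snoc (drop 3 S.var) (S.var 2)) (S.var 1)) U with hVdef
  have hdV : drop 3 V = drop 3 S.var := rfl
  -- `V` is compatible with sources and targets
  have hup : upN 3 (I.lift Γ Δ f) = snoc (snoc (snoc (comp (I.lift Γ Δ f) (drop 3 S.var))
      (S.var 2)) (S.var 1)) (S.var 0) := by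
    simp [upN_three, up_eq, drop_three]
  have hu2 := P.isMor_snd
  rw [hup, isMor_idCtx_cons RΔ hB] at hu2
  have sV : S.EqMor (I.pullbackStep Γ Δ f B ++ I.idCtx Γ) (B :: Δ)
      (comp (src (B :: Δ)) (upN 3 (I.lift Γ Δ f)))
      (comp (up f) (comp (src (S.subTy f B :: Γ)) V)) := by
    have := eqMor_snoc (eqMor_comp_right L.src P.isMor_fst) hB
      (S.eqTm_refl (by simpa using hu2.2.1))
    simpa [hup, hVdef, src, up_eq] using this
  have tV : S.EqMor (I.pullbackStep Γ Δ f B ++ I.idCtx Γ) (B :: Δ)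
      (comp (tgt (B :: Δ)) (upN 3 (I.lift Γ Δ f)))
      (comp (up f) (comp (tgt (S.subTy f B :: Γ)) V)) := by
    have := eqMor_snoc (eqMor_comp_right L.tgt P.isMor_fst) hB
      (S.eqTm_refl (by simpa using hu2.2.2.1))
    simpa [hup, hVdef, tgt, up_eq] using this
  -- The projection of the base change to the identity context of `Δ.B` preserves reflexivities,
  -- just as the lift of `up f` does.
  have hMR : S.EqMor (S.subTy f B :: Γ) (I.idCtx (B :: Δ))
      (comp (upN 3 (I.lift Γ Δ f)) (I.reflCtx (S.subTy f B :: Γ)))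
      (comp (I.reflCtx (B :: Δ)) (up f)) := by
    have h₂ := eqMor_right Lu.refl
    have h₃ : comp (I.reflCtx (B :: Δ)) (up f) =
        snoc (snoc (snoc (comp (comp (I.reflCtx Δ) f) S.wk) (S.var 0)) (S.var 0))
          (I.r (S.subTy S.wk (S.subTy f B)) (S.var 0)) := by
      simp [reflCtx, up_eq, I.r_sub]
    have h₄ : comp (upN 3 (I.lift Γ Δ f)) (I.reflCtx (S.subTy f B :: Γ)) =
        snoc (snoc (snoc (comp (comp (I.lift Γ Δ f) (I.reflCtx Γ)) S.wk) (S.var 0)) (S.var 0))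
          (I.r (S.subTy S.wk (S.subTy f B)) (S.var 0)) := by
      simp [hup, reflCtx, drop_three]
    rw [h₃] at h₂ ⊢
    rw [h₄]
    rw [isMor_idCtx_cons RΔ hB] at h₂
    exact eqMor_symm ((eqMor_idCtx_cons RΔ hB).2
      ⟨eqMor_symm (eqMor_comp_right L.refl (isMor_wk hA)), S.eqTm_refl h₂.2.1,
        S.eqTm_refl h₂.2.2.1, S.eqTm_refl h₂.2.2.2⟩)
  -- `V` is compatible with the projections
  have V₁ : S.EqMor (I.pullbackStep Γ Δ f B ++ I.idCtx Γ) (I.idCtx Γ)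
      (comp (I.lift (S.subTy f B :: Γ) Γ S.wk) V) (drop 3 S.var) := by
    have := eqMor_comp_right ew hV
    rwa [drop_var_comp, hdV] at this
  have V₂ : S.EqMor (I.pullbackStep Γ Δ f B ++ I.idCtx Γ) (I.idCtx (B :: Δ))
      (comp (I.lift (S.subTy f B :: Γ) (B :: Δ) (up f)) V) (upN 3 (I.lift Γ Δ f)) := by
    refine eqMor_of_elimAlong hΔB hRe (isMor_comp Lu.isMor hV) P.isMor_snd ?_ ?_ ?_
    · have := eqMor_comp_right Lu.src hV
      simp only [comp_assoc] at this
      exact eqMor_trans this (eqMor_symm sV)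
    · have := eqMor_comp_right Lu.tgt hV
      simp only [comp_assoc] at this
      exact eqMor_trans this (eqMor_symm tV)
    · have h₁ := eqMor_trans (eqMor_comp_left Lu.isMor hVR) Lu.refl
      rw [← comp_assoc] at h₁
      exact eqMor_trans h₁ (eqMor_symm hMR)
  -- the comparison in the other direction
  have hcomm : S.EqMor (I.idCtx (S.subTy f B :: Γ)) (I.idCtx Δ)
      (comp (I.lift Γ Δ f) (drop 3 S.var))
      (comp (drop 3 S.var) (I.lift (S.subTy f B :: Γ) (B :: Δ) (up f))) := by
    have h₁ := L.comp hf (liftRules_wk hA) (isMor_wk hA)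
    have h₂ := (liftRules_wk hB).comp (isMor_wk hB) Lu P₁.isMor_snd
    have e : comp S.wk (up f) = comp f S.wk := by simp [up_eq]
    rw [e] at h₂
    exact h₁.unique h₂ hΓA hΔ
  -- `W` is induced by the lifts of the projection and of `up f`; their square commutes because both
  -- composites lift the same morphism.
  obtain ⟨W, hW, W₁, W₂, -⟩ := P.exists_lift _ _ _ (liftRules_wk hA).isMor Lu.isMor hcomm
  have VW : S.EqMor (I.idCtx (S.subTy f B :: Γ)) (I.idCtx (S.subTy f B :: Γ)) (comp V W) S.var := by
    have hVW := isMor_comp hV hW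
    have h1 := isMor_var (isMor_dom RA.isMor_src)
    refine eqMor_of_elimAlong hΓA RA.elimAlong hVW h1 ?_ ?_ ?_
    · refine P₁.hom_ext (isMor_comp RA.isMor_src hVW) (isMor_comp RA.isMor_src h1) ?_ ?_
      · simpa [hVdef, src, drop_three] using eqMor_comp_left RΓ.isMor_src W₁
      · have e := eqMor_trans (eqMor_symm (eqMor_comp_right sV hW))
          (by simpa only [comp_assoc] using eqMor_comp_left RB.isMor_src W₂)
        simpa only [comp_assoc, comp_var] using eqMor_trans e Lu.src
    · refine P₁.hom_ext (isMor_comp RA.isMor_tgt hVW) (isMor_comp RA.isMor_tgt h1) ?_ ?_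
      · simpa [hVdef, tgt, drop_three] using eqMor_comp_left RΓ.isMor_tgt W₁
      · have e := eqMor_trans (eqMor_symm (eqMor_comp_right tV hW))
          (by simpa only [comp_assoc] using eqMor_comp_left RB.isMor_tgt W₂)
        simpa only [comp_assoc, comp_var] using eqMor_trans e Lu.tgt
    -- `W` preserves reflexivities, as both projections of the base change detect; since `V` does
    -- too, `V ∘ W` fixes them.
    · have hWR := P.hom_ext (isMor_comp hW RA.isMor_refl) hR
        (by simpa only [comp_assoc] using eqMor_comp_right W₁ RA.isMor_refl)
        (by simpa only [comp_assoc] using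
              eqMor_trans (eqMor_trans (eqMor_comp_right W₂ RA.isMor_refl) Lu.refl) (eqMor_symm hMR))
      simpa only [comp_assoc, var_comp] using eqMor_trans (eqMor_comp_left hV hWR) hVR
  exact P.of_retract Lw.isMor Lu.isMor (eqMor_symm ew') hV V₁ V₂ hW
    (eqMor_trans W₁ (eqMor_symm ew)) W₂ VW

end BaseChange

end DiscreteIdTypes

end TwoDimTT

theorem mainTheorem2 (S : TwoDimTT.TypeTheory.{u, v}) (I : TwoDimTT.DiscreteIdTypes S)
    (Γ Δ : S.Ctx) (f : S.Sub) (hf : S.IsMor Γ Δ f) (B : S.Ty) (hB : S.IsTy Δ B) :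
    I.IsTwoPullback (S.subTy f B :: Γ) Γ (B :: Δ) Δ
      S.wk (TwoDimTT.RawExpr.up f) f S.wk :=
  TwoDimTT.DiscreteIdTypes.isTwoPullback_of_isPullback_idCtx
    (TwoDimTT.DiscreteIdTypes.isPullback_up hf hB)
    (TwoDimTT.DiscreteIdTypes.isPullback_idCtx_lift hf hB)
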